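/- Let $\alpha\ge 0$ be fixed, and let $(a_k)_{k\ge1}$ and $(b_k)_{k\ge1}$ be two independent centered stationary Gaussian processes with the same correlation function, $\mathbb E[a_ka_l]=\mathbb E[b_kb_l]=\cos((k-l)\alpha)$ for all $k,l\ge1$. Let $$f_n(t)=\frac1{\sqrt n}\sum_{k=1}^n\big(a_k\cos(kt)+b_k\sin(kt)\big),$$ and let $\mathcal N(f_n,[0,2\pi])$ be the number of real zeros of $f_n$ in $[0,2\pi]$. For $x\in(0,\pi)$ let $$g_x^\alpha(s,u)=\frac{\sin(x)\,\sin\left(\frac{s-\alpha}2\right)\sin\left(\frac{s+\alpha}2\right)}{\sin^2\left(\frac{u-x}2\right)\sin^2\left(\frac{s+\alpha}2\right)+\sin^2\left(\frac{u+x}2\right)\sin^2\left(\frac{s-\alpha}2\right)},\qquad \ell^\alpha(x)=\frac1{4\pi^2}\int_{[0,2\pi]^2}\sqrt{1+|g_x^\alpha(s,u)|^2}\,ds\,du .$$ Then for every $0<\beta<1$ there are a constant $C$ and a sequence $\eta_n\to0$, depending only on $\alpha$ and $\beta$, such that for all sufficiently large $n$ with $n\alpha\notin\pi\mathbb Z$,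 the integral defining $\ell^\alpha(n\alpha \bmod \pi)$ converges, $\mathcal N(f_n,[0,2\pi])$ has finite expectation, and $$\left|\frac{\mathbb E[\mathcal N(f_n,[0,2\pi])]}{n}-\ell^\alpha(n\alpha \bmod \pi)\right|\le\frac{C}{n^\beta\,(1-|\cos(n\alpha)|)^2}+\eta_n ,$$ where $n\alpha \bmod \pi$ is the representative of $n\alpha$ modulo $\pi$ in $(0,\pi)$. -/

import Mathlib

open MeasureTheory ProbabilityTheory Filter Topology
open scoped ENNReal

noncomputable section

/-- `(a_k)_{k ≥ 1}` and `(b_k)_{k ≥ 1}` are independent centered Gaussian processes on `(Ω, P)`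
with the same correlation function `ρ(k) = cos (k α)`. Only the indices `k ≥ 1` matter. -/
structure IsCosineCoefficients {Ω : Type*} [MeasurableSpace Ω] (P : Measure Ω) (α : ℝ)
    (a b : ℕ → Ω → ℝ) : Prop where
  gaussian_a : IsGaussianProcess (fun (k : ℕ+) (ω : Ω) => a k ω) P
  gaussian_b : IsGaussianProcess (fun (k : ℕ+) (ω : Ω) => b k ω) P
  indep : IndepFun (fun (ω : Ω) (k : ℕ+) => a k ω) (fun (ω : Ω) (k : ℕ+) => b k ω) P
  mean_a : ∀ k : ℕ+, ∫ ω, a k ω ∂P = 0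
  mean_b : ∀ k : ℕ+, ∫ ω, b k ω ∂P = 0
  corr_a : ∀ k l : ℕ+, ∫ ω, a k ω * a l ω ∂P = Real.cos ((((k : ℕ) : ℝ) - ((l : ℕ) : ℝ)) * α)
  corr_b : ∀ k l : ℕ+, ∫ ω, b k ω * b l ω ∂P = Real.cos ((((k : ℕ) : ℝ) - ((l : ℕ) : ℝ)) * α)

/-- The trigonometric polynomial
`f_n(t) = n^{-1/2} ∑_{k=1}^n (a_k cos (k t) + b_k sin (k t))`. -/
def trigPoly (a b : ℕ → ℝ) (n : ℕ) (t : ℝ) : ℝ :=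
  1 / √(n : ℝ) * ∑ k ∈ Finset.Icc 1 n, (a k * Real.cos (k * t) + b k * Real.sin (k * t))

/-- The number (possibly infinite) of real zeros of `f` in the set `I`. -/
def zeroCount (f : ℝ → ℝ) (I : Set ℝ) : ℕ∞ := {t ∈ I | f t = 0}.encard

/-- The random variable `N(f_n, [0, 2π])`, valued in `[0, ∞]`. -/
def numZeros {Ω : Type*} (a b : ℕ → Ω → ℝ) (n : ℕ) (ω : Ω) : ℝ≥0∞ :=
  ((zeroCount (trigPoly (fun k => a k ω) (fun k => b k ω) n) (Set.Icc 0 (2 * Real.pi)) : ℕ∞) :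
    ℝ≥0∞)

/-- The function `g_x^α(s, u)`. -/
def gFun (α x s u : ℝ) : ℝ :=
  Real.sin x * Real.sin ((s - α) / 2) * Real.sin ((s + α) / 2) /
    (Real.sin ((u - x) / 2) ^ 2 * Real.sin ((s + α) / 2) ^ 2 +
      Real.sin ((u + x) / 2) ^ 2 * Real.sin ((s - α) / 2) ^ 2)

/-- The integrand `√(1 + |g_x^α(s, u)|²)` as a function of `p = (s, u)`. -/
def ellIntegrand (α x : ℝ) (p : ℝ × ℝ) : ℝ := √(1 + |gFun α x p.1 p.2| ^ 2)

/-- The square `[0, 2π]²`. -/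
def torusSquare : Set (ℝ × ℝ) :=
  Set.Icc 0 (2 * Real.pi) ×ˢ Set.Icc 0 (2 * Real.pi)

/-- `ℓ^α(x) = (4π²)⁻¹ ∫_{[0,2π]²} √(1 + |g_x^α(s, u)|²) ds du`. -/
def ell (α x : ℝ) : ℝ :=
  1 / (4 * Real.pi ^ 2) * ∫ p in torusSquare, ellIntegrand α x p

end

/-! A stationary Gaussian sequence with correlation cos((k-l)α) is degenerate: almost surely a_k = A
cos kα + B sin kα with A, B independent standard Gaussians, and likewise for b. Up to a scalar,
f_n(t) is therefore ⟨v(t), Z⟩ for a standard Gaussian vector Z in ℝ⁴ and a deterministic curve v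
(`cosineCurve`). By the Edelman–Kostlan formula the expected number of zeros is 1/π times the length
of v/|v| on the sphere, so the problem becomes deterministic.

In suitable coordinates v is the pair of sums ∑ e^{ik(t∓α)}, each a Dirichlet quotient times a
phase. This gives the angular speed in closed form: away from ±α it is (n/2)√(1 + g²), with g =
g_{nα}(t, nt), up to an explicit error (`abs_angularSpeed_sub_le`).

It remains to decouple the slow variable s from the fast variable u = nt. The integral over t is
averaged over translations t = s + r/n with 0 ≤ r ≤ 2π; for fixed s, the phase ns + r runs through
one period. Replacing the speed at t by the integrand at (s, nt) costs at most `errorMajorant` times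
`errorWeight`. The majorant has bounded integral in u, uniformly in n and s, because each kernel in
it has constant sign and is the derivative of 2 arctan of a quotient
(`integral_abs_poissonQuotient_le`). The weight tends to 0 for almost every s, so its integral tends
to 0. No step degrades as nα approaches πℤ, so the bound holds with C = 0 and η_n a multiple of the
integral of the weight. -/

/-! ### Area formula with multiplicities -/

section AreaFormula

/-- A subset of a second countable space on which `f` is locally injective splits into
countably many disjoint measurable pieces on which `f` is injective. -/
theorem exists_disjoint_measurable_injOn {E F : Type*} [TopologicalSpace E]
    [SecondCountableTopology E] [MeasurableSpace E] [BorelSpace E] {f : E → F} {s : Set E}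
    (hs : MeasurableSet s) (hf : ∀ x ∈ s, ∃ U ∈ 𝓝 x, Set.InjOn f U) :
    ∃ t : ℕ → Set E, (∀ i, MeasurableSet (t i)) ∧ Pairwise (Function.onFun Disjoint t) ∧
      (∀ i, Set.InjOn f (t i)) ∧ ⋃ i, t i = s := by
  choose! U hU hinj using hf
  obtain ⟨c, hcs, hc, hcov⟩ := TopologicalSpace.countable_cover_nhdsWithin
    (f := fun x => interior (U x)) (s := s)
    (fun x hx => mem_nhdsWithin_of_mem_nhds (interior_mem_nhds.2 (hU x hx)))
  rcases s.eq_empty_or_nonempty with rfl | hne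
  · exact ⟨fun _ => ∅, by simp, fun i j _ => by simp [Function.onFun], by simp, by simp⟩
  have hcne : c.Nonempty := by
    obtain ⟨x, hx⟩ := hne
    obtain ⟨y, hy, -⟩ := Set.mem_iUnion₂.1 (hcov hx)
    exact ⟨y, hy⟩
  obtain ⟨e, rfl⟩ := hc.exists_eq_range hcne
  refine ⟨disjointed (fun i => s ∩ interior (U (e i))), fun i => ?_, disjoint_disjointed _,
    fun i => ?_, ?_⟩
  · exact MeasurableSet.disjointed (fun i => hs.inter isOpen_interior.measurableSet) i
  · refine (hinj (e i) (hcs ⟨i, rfl⟩)).mono ((disjointed_subset _ i).trans ?_)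
    exact Set.inter_subset_right.trans interior_subset
  · rw [iUnion_disjointed, ← Set.inter_iUnion, Set.inter_eq_left]
    simpa using hcov

/-- The fibre cardinality of `f` on a measurable set on which it is injective. -/
theorem encard_fiber_of_injOn {E F : Type*} {f : E → F} {s : Set E} (h : Set.InjOn f s) (y : F) :
    (((s ∩ f ⁻¹' {y}).encard : ℕ∞) : ℝ≥0∞) = (f '' s).indicator (fun _ => 1) y := by
  by_cases hy : y ∈ f '' s
  · obtain ⟨x, hx, rfl⟩ := hy
    have : s ∩ f ⁻¹' {f x} = {x} := by
      ext z
      constructor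
      · rintro ⟨hz, hzx⟩
        exact h hz hx hzx
      · rintro rfl
        exact ⟨hx, rfl⟩
    simp [this, Set.mem_image_of_mem f hx]
  · have : s ∩ f ⁻¹' {y} = ∅ := by
      ext z
      simp only [Set.mem_inter_iff, Set.mem_preimage, Set.mem_singleton_iff,
        Set.mem_empty_iff_false, iff_false, not_and]
      intro hz hzy
      exact hy ⟨z, hz, hzy⟩
    simp [this, hy]

variable {E : Type*} [NormedAddCommGroup E] [NormedSpace ℝ E] [FiniteDimensional ℝ E]
  [MeasurableSpace E] [BorelSpace E]

/-- **Area formula**: the fibre cardinality of a continuously differentiable map is almost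
everywhere measurable, and its weighted integral is the integral of the Jacobian. -/
theorem area_formula (μ : Measure E) [μ.IsAddHaarMeasure] {f : E → E} {f' : E → E →L[ℝ] E}
    (hf : ∀ x, HasStrictFDerivAt f (f' x) x) (hf' : Measurable f') {s : Set E}
    (hs : MeasurableSet s) :
    AEMeasurable (fun y => (((s ∩ f ⁻¹' {y}).encard : ℕ∞) : ℝ≥0∞)) μ ∧
      ∀ φ : E → ℝ≥0∞, Measurable φ →
        ∫⁻ y, φ y * (((s ∩ f ⁻¹' {y}).encard : ℕ∞) : ℝ≥0∞) ∂μ =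
          ∫⁻ x in s, ENNReal.ofReal |(f' x).det| * φ (f x) ∂μ := by
  have hfc : Continuous f := continuous_iff_continuousAt.2 fun x => (hf x).continuousAt
  have hdet : Measurable fun x => (f' x).det := ContinuousLinearMap.continuous_det.measurable.comp hf'
  -- The critical set z contributes nothing to either side: its image is null (Sard) and the
  -- Jacobian vanishes on it. On r the inverse function theorem makes f locally injective, so r
  -- splits into countably many pieces where the change of variables applies.
  set r : Set E := s ∩ {x | (f' x).det ≠ 0}
  set z : Set E := s ∩ {x | (f' x).det = 0}
  have hr : MeasurableSet r := hs.inter (hdet (measurableSet_singleton 0).compl)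
  have hz : MeasurableSet z := hs.inter (hdet (measurableSet_singleton 0))
  obtain ⟨t, htm, htd, hti, htr⟩ := exists_disjoint_measurable_injOn (f := f) hr (by
    rintro x ⟨-, hx⟩
    have hsd := hf x
    rw [show f' x = ((f' x).toContinuousLinearEquivOfDetNeZero hx : E →L[ℝ] E) by ext; rfl] at hsd
    exact ⟨_, (hsd.toOpenPartialHomeomorph f).open_source.mem_nhds
      hsd.mem_toOpenPartialHomeomorph_source, (hsd.toOpenPartialHomeomorph f).injOn⟩)
  have himage : μ (f '' z) = 0 :=
    addHaar_image_eq_zero_of_det_fderivWithin_eq_zero μ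
      (fun x _ => (hf x).hasFDerivAt.hasFDerivWithinAt) fun x hx => hx.2
  have hcount : ∀ᵐ y ∂μ, (((s ∩ f ⁻¹' {y}).encard : ℕ∞) : ℝ≥0∞) =
      ∑' i, (f '' t i).indicator (fun _ => (1 : ℝ≥0∞)) y := by
    filter_upwards [compl_mem_ae_iff.2 himage] with y hy
    have h1 : s ∩ f ⁻¹' {y} = ⋃ i, t i ∩ f ⁻¹' {y} := by
      rw [← Set.iUnion_inter, htr]
      ext x
      constructor
      · rintro ⟨hx, hxy⟩
        refine ⟨⟨hx, fun h0 => hy ⟨x, ⟨hx, h0⟩, hxy⟩⟩, hxy⟩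
      · rintro ⟨hx, hxy⟩
        exact ⟨hx.1, hxy⟩
    have hm : ∀ i, MeasurableSet (t i ∩ f ⁻¹' {y}) := fun i =>
      (htm i).inter (hfc.measurable (measurableSet_singleton y))
    rw [← Measure.count_apply (hs.inter (hfc.measurable (measurableSet_singleton y))), h1,
      measure_iUnion (fun i j hij => (htd hij).mono Set.inter_subset_left Set.inter_subset_left) hm]
    exact tsum_congr fun i => by rw [Measure.count_apply (hm i), encard_fiber_of_injOn (hti i)]
  have hd : ∀ i, ∀ x ∈ t i, HasFDerivWithinAt f (f' x) (t i) x := fun i x _ =>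
    (hf x).hasFDerivAt.hasFDerivWithinAt
  have him : ∀ i, MeasurableSet (f '' t i) := fun i =>
    measurable_image_of_fderivWithin (htm i) (hd i) (hti i)
  have hmeas : ∀ i, Measurable ((f '' t i).indicator (fun _ => (1 : ℝ≥0∞))) := fun i =>
    measurable_const.indicator (him i)
  refine ⟨⟨_, Measurable.tsum hmeas, hcount⟩, fun φ hφ => ?_⟩
  calc ∫⁻ y, φ y * (((s ∩ f ⁻¹' {y}).encard : ℕ∞) : ℝ≥0∞) ∂μ
      = ∫⁻ y, ∑' i, (f '' t i).indicator φ y ∂μ := by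
        refine lintegral_congr_ae ?_
        filter_upwards [hcount] with y hy
        rw [hy, ← ENNReal.tsum_mul_left]
        refine tsum_congr fun i => ?_
        by_cases h : y ∈ f '' t i <;> simp [h]
    _ = ∑' i, ∫⁻ x in t i, ENNReal.ofReal |(f' x).det| * φ (f x) ∂μ := by
        rw [lintegral_tsum fun i => (hφ.indicator (him i)).aemeasurable]
        refine tsum_congr fun i => ?_
        rw [lintegral_indicator (him i),
          lintegral_image_eq_lintegral_abs_det_fderiv_mul μ (htm i) (hd i) (hti i)]
    _ = ∫⁻ x in r, ENNReal.ofReal |(f' x).det| * φ (f x) ∂μ := by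
        rw [← htr, lintegral_iUnion htm htd]
    _ = ∫⁻ x in s, ENNReal.ofReal |(f' x).det| * φ (f x) ∂μ := by
        have hz0 : ∫⁻ x in z, ENNReal.ofReal |(f' x).det| * φ (f x) ∂μ = 0 := by
          rw [setLIntegral_congr_fun hz (g := fun _ => 0) fun x hx => by
            simp [show (f' x).det = 0 from hx.2]]
          simp
        have hu : s = r ∪ z := by
          ext x
          by_cases h : (f' x).det = 0 <;> simp [r, z, h]
        have hdj : Disjoint r z := Set.disjoint_left.2 fun x hx hx' => hx.2 hx'.2
        conv_rhs => rw [hu]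
        rw [lintegral_union hz hdj, hz0, add_zero]

end AreaFormula

/-! ### Gaussian densities, absolute moments and linear images -/

section GaussianIntegrals

theorem lintegral_fin_prod_eq_prod {n : ℕ} {μ : Fin n → Measure ℝ} [∀ i, SigmaFinite (μ i)]
    {f : Fin n → ℝ → ℝ≥0∞} (hf : ∀ i, Measurable (f i)) :
    ∫⁻ x, ∏ i, f i (x i) ∂(Measure.pi μ) = ∏ i, ∫⁻ x, f i x ∂(μ i) := by
  induction n with
  | zero => simp
  | succ n ih =>
    have hp := (measurePreserving_piFinSuccAbove μ 0).symm
    rw [← hp.lintegral_comp (by fun_prop)]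
    simp_rw [MeasurableEquiv.piFinSuccAbove_symm_apply, Fin.insertNthEquiv, Fin.prod_univ_succ]
    simp only [Equiv.coe_fn_mk, Fin.insertNth_zero, Fin.cons_zero, Fin.cons_succ]
    rw [← ih fun i => hf i.succ]
    exact lintegral_prod_mul (μ := μ 0) (ν := Measure.pi fun i : Fin n => μ i.succ)
      (g := fun y => ∏ i, f i.succ (y i)) (hf 0).aemeasurable
      (Finset.measurable_fun_prod _ fun i _ => (hf i.succ).comp (measurable_pi_apply i)).aemeasurable

theorem pi_withDensity {n : ℕ} {μ : Fin n → Measure ℝ} [∀ i, SigmaFinite (μ i)]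
    {f : Fin n → ℝ → ℝ≥0∞} (hf : ∀ i, Measurable (f i))
    [∀ i, SigmaFinite ((μ i).withDensity (f i))] :
    Measure.pi (fun i => (μ i).withDensity (f i)) =
      (Measure.pi μ).withDensity fun x => ∏ i, f i (x i) := by
  refine (Measure.pi_eq fun s hs => ?_)
  rw [withDensity_apply _ (MeasurableSet.univ_pi hs),
    ← lintegral_indicator (MeasurableSet.univ_pi hs)]
  have : ∀ x : Fin n → ℝ, (Set.univ.pi s).indicator (fun x => ∏ i, f i (x i)) x =
      ∏ i, (s i).indicator (f i) (x i) := by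
    intro x
    by_cases hx : x ∈ Set.univ.pi s
    · rw [Set.indicator_of_mem hx]
      exact Finset.prod_congr rfl fun i _ => by
        rw [Set.indicator_of_mem (hx i (Set.mem_univ i))]
    · rw [Set.indicator_of_notMem hx]
      simp only [Set.mem_pi, Set.mem_univ, true_implies, not_forall] at hx
      obtain ⟨i, hi⟩ := hx
      exact (Finset.prod_eq_zero (Finset.mem_univ i) (Set.indicator_of_notMem hi _)).symm
  simp_rw [this]
  rw [lintegral_fin_prod_eq_prod fun i => (hf i).indicator (hs i)]
  exact Finset.prod_congr rfl fun i _ => by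
    rw [lintegral_indicator (hs i), withDensity_apply _ (hs i)]

theorem pi_gaussianReal_eq_withDensity (n : ℕ) {v : NNReal} (hv : v ≠ 0) :
    Measure.pi (fun _ : Fin n => gaussianReal 0 v) =
      (volume : Measure (Fin n → ℝ)).withDensity fun x => ∏ i, gaussianPDF 0 v (x i) := by
  have : SigmaFinite ((volume : Measure ℝ).withDensity (gaussianPDF 0 v)) := by
    rw [← gaussianReal_of_var_ne_zero 0 hv]
    infer_instance
  have h := pi_withDensity (n := n) (μ := fun _ => volume) (f := fun _ => gaussianPDF 0 v)
    fun _ => measurable_gaussianPDF 0 v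
  simp only [← gaussianReal_of_var_ne_zero 0 hv] at h
  exact h

theorem integral_abs_gaussianReal (v : NNReal) :
    ∫ x, |x| ∂(gaussianReal 0 v) = √(2 * v / Real.pi) := by
  by_cases hv : v = 0
  · simp [hv]
  have hv' : (0 : ℝ) < v := by positivity
  rw [integral_gaussianReal_eq_integral_smul hv]
  have h1 : ∀ x : ℝ, gaussianPDFReal 0 v x • |x| =
      (fun y => gaussianPDFReal 0 v y * y) |x| := by
    intro x
    simp [gaussianPDFReal_def]
  rw [integral_congr_ae (ae_of_all _ h1),
    integral_comp_abs (f := fun y => gaussianPDFReal 0 v y * y)]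
  have h2 : ∫ x in Set.Ioi (0 : ℝ), gaussianPDFReal 0 v x * x =
      (√(2 * Real.pi * v))⁻¹ * v := by
    have := integral_rpow_mul_exp_neg_mul_rpow (p := 2) (q := 1) (b := 1 / (2 * v))
      (by norm_num) (by norm_num) (by positivity)
    have h3 : ∫ x in Set.Ioi (0 : ℝ), x ^ (1 : ℝ) * Real.exp (-(1 / (2 * v)) * x ^ (2 : ℝ)) = v := by
      rw [this]
      norm_num
      rw [Real.rpow_neg_one]
      field_simp
    rw [show (√(2 * Real.pi * v))⁻¹ * (v : ℝ) = (√(2 * Real.pi * v))⁻¹ *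
      ∫ x in Set.Ioi (0 : ℝ), x ^ (1 : ℝ) * Real.exp (-(1 / (2 * v)) * x ^ (2 : ℝ)) by rw [h3],
      ← integral_const_mul]
    refine setIntegral_congr_fun measurableSet_Ioi fun x _ => ?_
    simp only [gaussianPDFReal_def, Real.rpow_one, Real.rpow_two, sub_zero]
    rw [show -(1 / (2 * (v : ℝ))) * x ^ 2 = -x ^ 2 / (2 * v) by ring]
    ring
  rw [h2]
  have hp := Real.pi_pos
  symm
  rw [Real.sqrt_eq_iff_mul_self_eq (by positivity) (by positivity)]
  have h0 : √(2 * Real.pi * v) ^ 2 = 2 * Real.pi * v := Real.sq_sqrt (by positivity)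
  have h4 : 2 * ((√(2 * Real.pi * v))⁻¹ * v) * (2 * ((√(2 * Real.pi * v))⁻¹ * v)) =
      4 * v ^ 2 / √(2 * Real.pi * v) ^ 2 := by
    field_simp
    norm_num
  rw [h4, h0]
  field_simp
  norm_num

theorem lintegral_abs_gaussianReal (v : NNReal) :
    ∫⁻ x, ENNReal.ofReal |x| ∂(gaussianReal 0 v) = ENNReal.ofReal √(2 * v / Real.pi) := by
  rw [← integral_abs_gaussianReal, ofReal_integral_eq_lintegral_ofReal]
  · exact ((memLp_id_gaussianReal 1).integrable (by norm_num)).abs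
  · exact ae_of_all _ fun x => abs_nonneg x

theorem map_linear_pi_gaussianReal {n : ℕ} (v : NNReal) (c : Fin n → ℝ) :
    (Measure.pi fun _ : Fin n => gaussianReal 0 v).map (fun y => ∑ i, c i * y i) =
      gaussianReal 0 (((∑ i, c i ^ 2) * v).toNNReal) := by
  set P := Measure.pi fun _ : Fin n => gaussianReal 0 v
  have hlaw : ∀ i, P.map (fun y => y i) = gaussianReal 0 v := fun i =>
    (measurePreserving_eval _ i).map_eq
  have hg0 : ∀ i, HasGaussianLaw (fun y : Fin n → ℝ => y i) P := fun i =>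
    ⟨by rw [hlaw i]; infer_instance⟩
  have hg : ∀ i, HasGaussianLaw (fun y : Fin n → ℝ => c i * y i) P := fun i =>
    (hg0 i).fun_smul (c i)
  have hind : iIndepFun (fun i (y : Fin n → ℝ) => c i * y i) P :=
    iIndepFun_pi (X := fun i (x : ℝ) => c i * x) fun i => by fun_prop
  have hi0 : ∀ i, ∫ y, y i ∂P = 0 := fun i => by
    have := integral_map (μ := P) (φ := fun y => y i) (measurable_pi_apply i).aemeasurable
      (f := fun x : ℝ => x) (by fun_prop)
    rw [← this, hlaw, integral_id_gaussianReal]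
  have hv0 : ∀ i, Var[fun y : Fin n → ℝ => y i; P] = v := fun i => by
    have := variance_map (X := id) (Y := fun y : Fin n → ℝ => y i) (μ := P)
      (by fun_prop) (measurable_pi_apply i).aemeasurable
    rw [hlaw, variance_id_gaussianReal] at this
    exact this.symm
  rw [(hind.hasGaussianLaw_fun_sum hg).map_eq_gaussianReal]
  congr 2
  · rw [integral_finsetSum _ fun i _ => (hg i).integrable]
    simp [integral_const_mul, hi0]
  · have := IndepFun.variance_sum (μ := P) (s := Finset.univ)
      (X := fun i (y : Fin n → ℝ) => c i * y i) (fun i _ => (hg i).memLp_two)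
      fun i _ j _ hij => hind.indepFun hij
    have h2 : (∑ i, fun y : Fin n → ℝ => c i * y i) = fun y => ∑ i, c i * y i := by
      ext y; simp
    rw [h2] at this
    rw [this, Finset.sum_mul]
    exact Finset.sum_congr rfl fun i _ => by rw [variance_const_mul, hv0]

end GaussianIntegrals

/-! ### Edelman–Kostlan formula in ℝ⁴ through the quaternion frame -/

section CroftonFormula

/-- The components `⟨Jᵢ w, v⟩` of `w` along the frame `Jᵢ v` orthogonal to `v`, up to sign, where
`Jᵢ` are the quaternion units. -/
def wedge (v w : Fin 4 → ℝ) : Fin 3 → ℝ :=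
  ![w 0 * v 1 - w 1 * v 0 + w 2 * v 3 - w 3 * v 2,
    w 0 * v 2 - w 2 * v 0 + w 3 * v 1 - w 1 * v 3,
    w 0 * v 3 - w 3 * v 0 + w 1 * v 2 - w 2 * v 1]

/-- The vector with coordinates `y` in the frame orthogonal to `v` given by the quaternion units. -/
def frameMap (v : Fin 4 → ℝ) (y : Fin 3 → ℝ) : Fin 4 → ℝ :=
  ![-(y 0 * v 1) - y 1 * v 2 - y 2 * v 3, y 0 * v 0 + y 1 * v 3 - y 2 * v 2,
    -(y 0 * v 3) + y 1 * v 0 + y 2 * v 1, y 0 * v 2 - y 1 * v 1 + y 2 * v 0]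

/-- The Jacobian matrix of `(t, y) ↦ frameMap (v t) y` when `v` has derivative `w` at `t`. -/
def frameJacobian (v w : Fin 4 → ℝ) (y : Fin 3 → ℝ) : Matrix (Fin 4) (Fin 4) ℝ :=
  !![frameMap w y 0, -v 1, -v 2, -v 3;
     frameMap w y 1, v 0, v 3, -v 2;
     frameMap w y 2, -v 3, v 0, v 1;
     frameMap w y 3, v 2, -v 1, v 0]

/-- The vectors v, J₁v, J₂v, J₃v are orthogonal and all of length |v|, so this is Parseval for w
with the v-component moved to the right-hand side. The result is the squared area spanned by v and
w. -/
theorem sum_wedge_sq (v w : Fin 4 → ℝ) :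
    ∑ i, wedge v w i ^ 2 = (∑ i, v i ^ 2) * ∑ i, w i ^ 2 - (∑ i, v i * w i) ^ 2 := by
  simp [wedge, Fin.sum_univ_succ]
  ring

/-- The last three columns are the frame Jᵢv, so only the component of the first column along v
survives, and ⟨v, frameMap w y⟩ is the linear form `wedge v w` evaluated at y. -/
theorem frameJacobian_det (v w : Fin 4 → ℝ) (y : Fin 3 → ℝ) :
    (frameJacobian v w y).det = (∑ i, v i ^ 2) * ∑ i, wedge v w i * y i := by
  simp [frameJacobian, frameMap, wedge, Matrix.det_succ_row_zero, Fin.sum_univ_succ,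
    Fin.succAbove]
  ring

theorem sum_frameMap_sq (v : Fin 4 → ℝ) (y : Fin 3 → ℝ) :
    ∑ i, frameMap v y i ^ 2 = (∑ i, v i ^ 2) * ∑ i, y i ^ 2 := by
  simp [frameMap, Fin.sum_univ_succ]
  ring

theorem sum_mul_frameMap (v : Fin 4 → ℝ) (y : Fin 3 → ℝ) : ∑ i, v i * frameMap v y i = 0 := by
  simp [frameMap, Fin.sum_univ_succ]
  ring

theorem frameMap_injective {v : Fin 4 → ℝ} (hv : ∑ i, v i ^ 2 ≠ 0) :
    Function.Injective (frameMap v) := by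
  intro y y' h
  have hsub : frameMap v (y - y') = 0 := by
    have : frameMap v (y - y') = frameMap v y - frameMap v y' := by
      ext i
      fin_cases i <;> simp [frameMap] <;> ring
    rw [this, h, sub_self]
  have h0 := sum_frameMap_sq v (y - y')
  rw [hsub] at h0
  simp only [Pi.zero_apply, ne_eq, OfNat.ofNat_ne_zero, not_false_eq_true, zero_pow,
    Finset.sum_const_zero] at h0
  have h1 := (mul_eq_zero.1 h0.symm).resolve_left hv
  rw [Finset.sum_eq_zero_iff_of_nonneg fun i _ => sq_nonneg _] at h1
  ext i
  simpa [sub_eq_zero] using h1 i (Finset.mem_univ i)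

theorem exists_frameMap_eq {v z : Fin 4 → ℝ} (hv : ∑ i, v i ^ 2 ≠ 0)
    (hz : ∑ i, v i * z i = 0) : ∃ y, frameMap v y = z := by
  set s := ∑ i, v i ^ 2 with hs
  -- The frame is orthogonal with vectors of squared length s, so the coordinates of z are ⟨Jᵢv, z⟩
  -- / s; antisymmetry of Jᵢ gives the minus sign.
  refine ⟨fun i => -(wedge v z i) / s, ?_⟩
  simp only [Fin.sum_univ_four] at hz hs
  ext i
  fin_cases i <;> simp [frameMap, wedge] <;> field_simp <;> rw [hs]
  · linear_combination (-v 0) * hz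
  · linear_combination (-v 1) * hz
  · linear_combination (-v 2) * hz
  · linear_combination (-v 3) * hz

variable {v w : ℝ → Fin 4 → ℝ}

/-- For each t, y ↦ frameMap (v t) y parametrizes the hyperplane orthogonal to v t bijectively, so a
preimage (t, y) of z is the same thing as a zero t of ⟨v t, z⟩. This turns the area formula into a
count of zeros. -/
theorem encard_frameMap_fiber (hv0 : ∀ t, ∑ i, v t i ^ 2 ≠ 0) (I : Set ℝ) (z : Fin 4 → ℝ) :
    ({p : Fin 4 → ℝ | p 0 ∈ I} ∩ (fun p => frameMap (v (p 0)) (Fin.tail p)) ⁻¹' {z}).encard =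
      {t ∈ I | ∑ i, v t i * z i = 0}.encard := by
  rw [← Set.InjOn.encard_image (f := fun p : Fin 4 → ℝ => p 0)]
  · congr 1
    ext t
    constructor
    · rintro ⟨p, ⟨hp, hpz⟩, rfl⟩
      refine ⟨hp, ?_⟩
      rw [← show frameMap (v (p 0)) (Fin.tail p) = z from hpz]
      exact sum_mul_frameMap _ _
    · rintro ⟨ht, htz⟩
      obtain ⟨y, hy⟩ := exists_frameMap_eq (hv0 t) htz
      exact ⟨Fin.cons t y, ⟨by simpa using ht, by simpa using hy⟩, by simp⟩
  · rintro p ⟨-, hp⟩ p' ⟨-, hp'⟩ h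
    have h' : p 0 = p' 0 := h
    have h1 : frameMap (v (p 0)) (Fin.tail p) = z := hp
    have h2 : frameMap (v (p' 0)) (Fin.tail p') = z := hp'
    rw [← h'] at h2
    have h3 := frameMap_injective (hv0 _) (h1.trans h2.symm)
    rw [← Fin.cons_self_tail p, ← Fin.cons_self_tail p', h3, h']

theorem hasStrictFDerivAt_frameMap (hv : ∀ t i, HasDerivAt (fun t => v t i) (w t i) t)
    (hw : ∀ i, Continuous fun t => w t i) (p : Fin 4 → ℝ) :
    HasStrictFDerivAt (fun p : Fin 4 → ℝ => frameMap (v (p 0)) (Fin.tail p))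
      (LinearMap.toContinuousLinearMap
        (Matrix.toLin' (frameJacobian (v (p 0)) (w (p 0)) (Fin.tail p)))) p := by
  have hproj : ∀ i : Fin 4, HasStrictFDerivAt (fun p : Fin 4 → ℝ => p i)
      (ContinuousLinearMap.proj i : (Fin 4 → ℝ) →L[ℝ] ℝ) p := fun i =>
    (ContinuousLinearMap.proj i : (Fin 4 → ℝ) →L[ℝ] ℝ).hasStrictFDerivAt
  have hvs : ∀ i, HasStrictFDerivAt (fun p : Fin 4 → ℝ => v (p 0) i)
      (w (p 0) i • (ContinuousLinearMap.proj 0 : (Fin 4 → ℝ) →L[ℝ] ℝ)) p := fun i =>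
    (hasStrictDerivAt_of_hasDerivAt_of_continuousAt
      (Eventually.of_forall fun t => hv t i) (hw i).continuousAt).comp_hasStrictFDerivAt
        (f := fun p : Fin 4 → ℝ => p 0) p (hproj 0)
  rw [hasStrictFDerivAt_pi']
  intro i
  -- Every coordinate of the map is a signed sum of three products yⱼ vₐ(t), so one product-rule
  -- computation serves all four rows.
  have key : ∀ a b c : Fin 4, ∀ σ₁ σ₂ σ₃ : ℝ, HasStrictFDerivAt
      (fun p : Fin 4 → ℝ => σ₁ * (p 1 * v (p 0) a) + σ₂ * (p 2 * v (p 0) b) +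
        σ₃ * (p 3 * v (p 0) c)) _ p := fun a b c σ₁ σ₂ σ₃ =>
    ((((hproj 1).mul (hvs a)).const_mul σ₁).add (((hproj 2).mul (hvs b)).const_mul σ₂)).add
      (((hproj 3).mul (hvs c)).const_mul σ₃)
  fin_cases i
  · convert! key 1 2 3 (-1) (-1) (-1) using 1
    · ext p; simp [frameMap, Fin.tail]; ring
    · ext q; simp [frameJacobian, frameMap, Fin.tail, dotProduct, Fin.sum_univ_four]
      ring
  · convert! key 0 3 2 1 1 (-1) using 1
    · ext p; simp [frameMap, Fin.tail]; ring
    · ext q; simp [frameJacobian, frameMap, Fin.tail, dotProduct, Fin.sum_univ_four]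
      ring
  · convert! key 3 0 1 (-1) 1 1 using 1
    · ext p; simp [frameMap, Fin.tail]
    · ext q; simp [frameJacobian, frameMap, Fin.tail, dotProduct, Fin.sum_univ_four]
      ring
  · convert! key 2 1 0 1 (-1) 1 using 1
    · ext p; simp [frameMap, Fin.tail]; ring
    · ext q; simp [frameJacobian, frameMap, Fin.tail, dotProduct, Fin.sum_univ_four]
      ring

theorem measurable_frameJacobian (hv : ∀ i, Continuous fun t => v t i)
    (hw : ∀ i, Continuous fun t => w t i) :
    Measurable fun p : Fin 4 → ℝ => LinearMap.toContinuousLinearMap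
        (Matrix.toLin' (frameJacobian (v (p 0)) (w (p 0)) (Fin.tail p))) := by
  have hL : Continuous fun M : Matrix (Fin 4) (Fin 4) ℝ =>
      LinearMap.toContinuousLinearMap (Matrix.toLin' M) :=
    LinearMap.continuous_of_finiteDimensional
      (LinearMap.toContinuousLinearMap.toLinearMap ∘ₗ (Matrix.toLin' (R := ℝ)).toLinearMap)
  refine (hL.comp ?_).measurable
  refine continuous_matrix fun i j => ?_
  fin_cases i <;> fin_cases j <;> simp [frameJacobian, frameMap, Fin.tail] <;> fun_prop

/-- Since `frameMap v` is |v| times an isometry, the standard density pulls back to a centered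
Gaussian density of variance |v|⁻² in y; the prefactor corrects the normalization, which passes from
dimension four to three. -/
theorem prod_gaussianPDF_frameMap {v : Fin 4 → ℝ} (hv : 0 < ∑ i, v i ^ 2) (y : Fin 3 → ℝ) :
    ∏ i, gaussianPDF 0 1 (frameMap v y i) =
      ENNReal.ofReal ((√(2 * Real.pi))⁻¹ ^ 4 * √(2 * Real.pi * (∑ i, v i ^ 2)⁻¹) ^ 3) *
        ∏ i, gaussianPDF 0 (∑ i, v i ^ 2)⁻¹.toNNReal (y i) := by
  have hs := sum_frameMap_sq v y
  set s := ∑ i, v i ^ 2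
  have hp := Real.pi_pos
  have h0 : √(2 * Real.pi * s⁻¹) ≠ 0 := by positivity
  simp only [gaussianPDF]
  rw [← ENNReal.ofReal_prod_of_nonneg fun i _ => gaussianPDFReal_nonneg _ _ _,
    ← ENNReal.ofReal_prod_of_nonneg fun i _ => gaussianPDFReal_nonneg _ _ _,
    ← ENNReal.ofReal_mul (by positivity)]
  congr 1
  simp only [gaussianPDFReal_def, Finset.prod_mul_distrib, Finset.prod_const, Finset.card_univ,
    Fintype.card_fin, ← Real.exp_sum, NNReal.coe_one, mul_one, sub_zero,
    Real.coe_toNNReal _ (inv_nonneg.2 hv.le), ← Finset.sum_div, Finset.sum_neg_distrib, hs]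
  rw [show -(s * ∑ i, y i ^ 2) / 2 = -(∑ i, y i ^ 2) / (2 * s⁻¹) by field_simp]
  field_simp

/-- Under the pulled-back Gaussian, ∑ cᵢyᵢ is centered of variance |c|²/|v|², and the mean of |N(0,
σ²)| is σ√(2/π). -/
theorem lintegral_abs_frame {v : Fin 4 → ℝ} (hv : 0 < ∑ i, v i ^ 2) (c : Fin 3 → ℝ) :
    ∫⁻ y : Fin 3 → ℝ, ENNReal.ofReal |(∑ i, v i ^ 2) * ∑ i, c i * y i| *
        ∏ i, gaussianPDF 0 1 (frameMap v y i) =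
      ENNReal.ofReal (√(∑ i, c i ^ 2) / (Real.pi * ∑ i, v i ^ 2)) := by
  simp_rw [prod_gaussianPDF_frameMap hv]
  set s := ∑ i, v i ^ 2
  set r := s⁻¹.toNNReal with hr
  have hr0 : r ≠ 0 := (Real.toNNReal_pos.2 (inv_pos.2 hv)).ne'
  have hrs : (r : ℝ) = s⁻¹ := Real.coe_toNNReal _ (inv_nonneg.2 hv.le)
  set k := (√(2 * Real.pi))⁻¹ ^ 4 * √(2 * Real.pi * s⁻¹) ^ 3 with hk
  have hp := Real.pi_pos
  have hk0 : 0 ≤ k := by positivity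
  set q := ∑ i, c i ^ 2 with hq
  have hq0 : 0 ≤ q := Finset.sum_nonneg fun i _ => sq_nonneg _
  calc ∫⁻ y : Fin 3 → ℝ, ENNReal.ofReal |s * ∑ i, c i * y i| *
        (ENNReal.ofReal k * ∏ i, gaussianPDF 0 r (y i))
      = ENNReal.ofReal (k * s) * ∫⁻ y : Fin 3 → ℝ, (∏ i, gaussianPDF 0 r (y i)) *
          ENNReal.ofReal |∑ i, c i * y i| := by
        rw [← lintegral_const_mul _ (by fun_prop)]
        refine lintegral_congr fun y => ?_
        rw [abs_mul, abs_of_pos hv, ENNReal.ofReal_mul hv.le, ENNReal.ofReal_mul hk0]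
        ring
    _ = ENNReal.ofReal (k * s) * ∫⁻ y, ENNReal.ofReal |∑ i, c i * y i|
          ∂(Measure.pi fun _ : Fin 3 => gaussianReal 0 r) := by
        rw [pi_gaussianReal_eq_withDensity 3 hr0, lintegral_withDensity_eq_lintegral_mul _
          (by fun_prop) (by fun_prop)]
        rfl
    _ = ENNReal.ofReal (k * s) * ENNReal.ofReal √(2 * (q * s⁻¹) / Real.pi) := by
        rw [← lintegral_map (f := fun x => ENNReal.ofReal |x|) (by fun_prop) (by fun_prop),
          map_linear_pi_gaussianReal, lintegral_abs_gaussianReal, ← hq, hrs,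
          Real.coe_toNNReal _ (by positivity)]
    _ = ENNReal.ofReal (√q / (Real.pi * s)) := by
        rw [← ENNReal.ofReal_mul (by positivity)]
        congr 1
        have h2 : √(2 * Real.pi) ^ 2 = 2 * Real.pi := Real.sq_sqrt (by positivity)
        have hs2 : √s ^ 2 = s := Real.sq_sqrt hv.le
        have hs0 : 0 < √s := Real.sqrt_pos.2 hv
        have h2p : 0 < √(2 * Real.pi) := by positivity
        have e1 : √(2 * Real.pi * s⁻¹) = √(2 * Real.pi) / √s := by
          rw [← div_eq_mul_inv, Real.sqrt_div' _ hv.le]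
        have e2 : √(2 * (q * s⁻¹) / Real.pi) = 2 * √q / (√s * √(2 * Real.pi)) := by
          rw [Real.sqrt_eq_iff_mul_self_eq (by positivity) (by positivity)]
          have : 2 * √q / (√s * √(2 * Real.pi)) * (2 * √q / (√s * √(2 * Real.pi))) =
              4 * √q ^ 2 / (√s ^ 2 * √(2 * Real.pi) ^ 2) := by
            field_simp
            ring
          rw [this, h2, hs2, Real.sq_sqrt hq0]
          field_simp
          ring
        rw [hk, e1, e2]
        have : (√(2 * Real.pi))⁻¹ ^ 4 * (√(2 * Real.pi) / √s) ^ 3 * s *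
            (2 * √q / (√s * √(2 * Real.pi))) =
            2 * s * √q / ((√s ^ 2) ^ 2 * √(2 * Real.pi) ^ 2) := by
          field_simp
        rw [this, h2, hs2]
        field_simp

theorem setLIntegral_fin_cons {n : ℕ} {F : ℝ × (Fin n → ℝ) → ℝ≥0∞} (hF : Measurable F)
    (I : Set ℝ) :
    ∫⁻ p in {p : Fin (n + 1) → ℝ | p 0 ∈ I}, F (p 0, Fin.tail p) =
      ∫⁻ t in I, ∫⁻ y, F (t, y) := by
  have hset : {p : Fin (n + 1) → ℝ | p 0 ∈ I} =
      MeasurableEquiv.piFinSuccAbove (fun _ : Fin (n + 1) => ℝ) 0 ⁻¹' (I ×ˢ Set.univ) := by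
    ext p
    simp [MeasurableEquiv.piFinSuccAbove, Fin.insertNthEquiv]
  rw [hset]
  refine ((volume_preserving_piFinSuccAbove
    (fun _ : Fin (n + 1) => ℝ) 0).setLIntegral_comp_preimage_emb
      (MeasurableEquiv.measurableEmbedding _) F _).trans ?_
  rw [Measure.volume_eq_prod, ← Measure.prod_restrict, Measure.restrict_univ,
    lintegral_prod _ hF.aemeasurable]

/-- **Edelman–Kostlan formula** in dimension four: the expected number of zeros of a standard
Gaussian linear combination of four functions is the length of the corresponding curve on the
sphere, divided by `π`. -/
theorem expected_zeros_of_gaussian_combination (hv : ∀ t i, HasDerivAt (fun t => v t i) (w t i) t)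
    (hw : ∀ i, Continuous fun t => w t i) (hv0 : ∀ t, 0 < ∑ i, v t i ^ 2) {I : Set ℝ}
    (hI : MeasurableSet I) :
    AEMeasurable (fun z : Fin 4 → ℝ => (({t ∈ I | ∑ i, v t i * z i = 0}.encard : ℕ∞) : ℝ≥0∞))
        (Measure.pi fun _ => gaussianReal 0 1) ∧
      ∫⁻ z, (({t ∈ I | ∑ i, v t i * z i = 0}.encard : ℕ∞) : ℝ≥0∞)
          ∂(Measure.pi fun _ => gaussianReal 0 1) =
        ∫⁻ t in I, ENNReal.ofReal
          (√(∑ i, wedge (v t) (w t) i ^ 2) / (Real.pi * ∑ i, v t i ^ 2)) := by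
  have hvc : ∀ i, Continuous fun t => v t i := fun i =>
    continuous_iff_continuousAt.2 fun t => (hv t i).continuousAt
  have hA : MeasurableSet {p : Fin 4 → ℝ | p 0 ∈ I} := measurable_pi_apply 0 hI
  -- With the Gaussian density as weight, the area formula equates the expected number of zeros with
  -- an integral over (t, y), whose y-part is `lintegral_abs_frame`.
  obtain ⟨hm, hint⟩ := area_formula volume (hasStrictFDerivAt_frameMap hv hw)
    (measurable_frameJacobian hvc hw) hA
  simp_rw [encard_frameMap_fiber (fun t => (hv0 t).ne')] at hm hint
  rw [pi_gaussianReal_eq_withDensity 4 one_ne_zero]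
  have hden : Measurable fun z : Fin 4 → ℝ => ∏ i, gaussianPDF 0 1 (z i) := by fun_prop
  refine ⟨hm.mono_ac (withDensity_absolutelyContinuous _ _), ?_⟩
  rw [lintegral_withDensity_eq_lintegral_mul₀ hden.aemeasurable hm]
  simp only [Pi.mul_apply]
  rw [hint _ hden]
  have hdet : ∀ M : Matrix (Fin 4) (Fin 4) ℝ,
      (LinearMap.toContinuousLinearMap (Matrix.toLin' M)).det = M.det := fun M => by
    simp [ContinuousLinearMap.det]
  simp only [hdet, frameJacobian_det]
  have hvm : ∀ i, Measurable fun t => v t i := fun i => (hvc i).measurable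
  have hwm : ∀ i, Measurable fun t => w t i := fun i => (hw i).measurable
  set F : ℝ × (Fin 3 → ℝ) → ℝ≥0∞ := fun p =>
    ENNReal.ofReal |(∑ i, v p.1 i ^ 2) * ∑ i, wedge (v p.1) (w p.1) i * p.2 i| *
      ∏ i, gaussianPDF 0 1 (frameMap (v p.1) p.2 i) with hF
  have hFm : Measurable F := by
    have h1 : ∀ i, Measurable fun p : ℝ × (Fin 3 → ℝ) => v p.1 i := fun i =>
      (hvm i).comp measurable_fst
    have h2 : ∀ i, Measurable fun p : ℝ × (Fin 3 → ℝ) => w p.1 i := fun i =>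
      (hwm i).comp measurable_fst
    have h3 : ∀ i, Measurable fun p : ℝ × (Fin 3 → ℝ) => p.2 i := fun i =>
      (measurable_pi_apply i).comp measurable_snd
    have h4 : Measurable fun p : ℝ × (Fin 3 → ℝ) =>
        (∑ i, v p.1 i ^ 2) * ∑ i, wedge (v p.1) (w p.1) i * p.2 i := by
      refine Measurable.mul (Finset.measurable_fun_sum _ fun i _ => (h1 i).pow_const 2)
        (Finset.measurable_fun_sum _ fun i _ => Measurable.mul ?_ (h3 i))
      fin_cases i <;> simp [wedge] <;> fun_prop
    refine (ENNReal.measurable_ofReal.comp (continuous_abs.measurable.comp h4)).mul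
      (Finset.measurable_fun_prod _ fun i _ => (measurable_gaussianPDF 0 1).comp ?_)
    fin_cases i <;> simp [frameMap] <;> fun_prop
  have h6 : ∀ t, ∫⁻ y, F (t, y) = ENNReal.ofReal
      (√(∑ i, wedge (v t) (w t) i ^ 2) / (Real.pi * ∑ i, v t i ^ 2)) := fun t => by
    rw [← lintegral_abs_frame (hv0 t) (wedge (v t) (w t))]
  have h5 := setLIntegral_fin_cons hFm I
  simp_rw [h6] at h5
  rw [← h5]

end CroftonFormula

/-! ### Reduction to four Gaussian variables -/

section CosineCoefficients

/-- The curve in `ℝ⁴` whose Gaussian linear combinations are the trigonometric polynomials with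
coefficients correlated by `cos (k α)`. -/
noncomputable def cosineCurve (α : ℝ) (n : ℕ) (t : ℝ) : Fin 4 → ℝ :=
  ![∑ k ∈ Finset.Icc 1 n, Real.cos (k * α) * Real.cos (k * t),
    ∑ k ∈ Finset.Icc 1 n, Real.sin (k * α) * Real.cos (k * t),
    ∑ k ∈ Finset.Icc 1 n, Real.cos (k * α) * Real.sin (k * t),
    ∑ k ∈ Finset.Icc 1 n, Real.sin (k * α) * Real.sin (k * t)]

variable {Ω : Type*} [MeasurableSpace Ω] {P : Measure Ω}

theorem integral_sum_mul_sum {ι κ : Type*} [Fintype ι] [Fintype κ] (c : ι → ℝ) (d : κ → ℝ)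
    {Y : ι → Ω → ℝ} {Z : κ → Ω → ℝ} (h : ∀ i j, Integrable (fun ω => Y i ω * Z j ω) P) :
    ∫ ω, (∑ i, c i * Y i ω) * (∑ j, d j * Z j ω) ∂P =
      ∑ i, ∑ j, c i * d j * ∫ ω, Y i ω * Z j ω ∂P := by
  have h1 : ∀ ω, (∑ i, c i * Y i ω) * (∑ j, d j * Z j ω) =
      ∑ i, ∑ j, c i * d j * (Y i ω * Z j ω) := fun ω => by
    rw [Finset.sum_mul_sum]
    exact Finset.sum_congr rfl fun i _ => Finset.sum_congr rfl fun j _ => by ring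
  simp_rw [h1]
  rw [integral_finsetSum _ fun i _ => integrable_finsetSum _ fun j _ => (h i j).const_mul _]
  refine Finset.sum_congr rfl fun i _ => ?_
  rw [integral_finsetSum _ fun j _ => (h i j).const_mul _]
  exact Finset.sum_congr rfl fun j _ => integral_const_mul _ _

/-- A centered Gaussian process with correlation `cos ((k - l) α)` is spanned by its first two
values. -/
theorem ae_eq_combination_of_cosine_correlation {α : ℝ} (hα : Real.sin α ≠ 0)
    {X : ℕ+ → Ω → ℝ} (hX : IsGaussianProcess X P)
    (hc : ∀ k l : ℕ+, ∫ ω, X k ω * X l ω ∂P =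
      Real.cos ((((k : ℕ) : ℝ) - ((l : ℕ) : ℝ)) * α)) (k : ℕ+) :
    ∀ᵐ ω ∂P, X k ω =
      (X 1 ω * Real.sin (2 * α) - X 2 ω * Real.sin α) / Real.sin α * Real.cos ((k : ℕ) * α) +
      (X 2 ω * Real.cos α - X 1 ω * Real.cos (2 * α)) / Real.sin α * Real.sin ((k : ℕ) * α) := by
  have hL : ∀ k, MemLp (X k) 2 P := fun k => (hX.hasGaussianLaw_eval k).memLp_two
  set φ := (((k : ℕ) : ℝ) - 1) * α with hφ
  -- These are the coefficients of the linear dependence between the unit vectors of angles kα, α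
  -- and 2α. The same combination of X k, X 1, X 2 has second moment zero, hence vanishes almost
  -- surely.
  set c : Fin 3 → ℝ := ![Real.sin α, Real.sin (φ - α), -Real.sin φ]
  set Y : Fin 3 → Ω → ℝ := ![X k, X 1, X 2]
  have hY : ∀ i, MemLp (Y i) 2 P := fun i => by fin_cases i <;> exact hL _
  have hint : ∀ i j, Integrable (fun ω => Y i ω * Y j ω) P := fun i j =>
    (hY i).integrable_mul (hY j)
  have h0 := integral_sum_mul_sum c c hint
  have e1 : Real.cos ((((k : ℕ) : ℝ) - 2) * α) = Real.cos (φ - α) := by congr 1; rw [hφ]; ring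
  have e2 : Real.cos ((2 - ((k : ℕ) : ℝ)) * α) = Real.cos (φ - α) := by
    rw [← Real.cos_neg]; congr 1; rw [hφ]; ring
  have e3 : Real.cos ((1 - ((k : ℕ) : ℝ)) * α) = Real.cos φ := by
    rw [← Real.cos_neg]; congr 1; rw [hφ]; ring
  have hz : ∫ ω, (∑ i, c i * Y i ω) * (∑ j, c j * Y j ω) ∂P = 0 := by
    rw [h0]
    simp [Fin.sum_univ_three, c, Y, hc, e1, e2, e3]
    rw [← hφ, show (1 - 2 : ℝ) * α = -α by ring, show (2 - 1 : ℝ) * α = α by ring, Real.cos_neg,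
      Real.sin_sub, Real.cos_sub]
    have h1 := Real.sin_sq_add_cos_sq α
    have h2 := Real.sin_sq_add_cos_sq φ
    have h3 : Real.cos α ^ 2 = 1 - Real.sin α ^ 2 := by linarith
    have h4 : Real.cos φ ^ 2 = 1 - Real.sin φ ^ 2 := by linarith
    ring_nf
    simp only [h3, h4]
    ring
  have hint2 : Integrable (fun ω => (∑ i, c i * Y i ω) * (∑ j, c j * Y j ω)) P := by
    have hm : MemLp (fun ω => ∑ i, c i * Y i ω) 2 P :=
      memLp_finsetSum _ fun i _ => (hY i).const_mul (c i)
    exact hm.integrable_mul hm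
  rw [integral_eq_zero_iff_of_nonneg (fun ω => mul_self_nonneg _) hint2] at hz
  filter_upwards [hz] with ω hω
  have h5 : ∑ i, c i * Y i ω = 0 := mul_self_eq_zero.1 hω
  simp [Fin.sum_univ_three, c, Y] at h5
  have e5 : ((k : ℕ) : ℝ) * α = φ + α := by rw [hφ]; ring
  rw [e5]
  field_simp
  have h6 : Real.sin (2 * α - (φ + α)) = Real.sin (2 * α) * Real.cos (φ + α) -
      Real.cos (2 * α) * Real.sin (φ + α) := Real.sin_sub _ _
  have h7 : Real.sin (φ + α - α) = Real.sin (φ + α) * Real.cos α -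
      Real.cos (φ + α) * Real.sin α := Real.sin_sub _ _
  rw [show 2 * α - (φ + α) = -(φ - α) by ring, Real.sin_neg] at h6
  rw [add_sub_cancel_right] at h7
  linear_combination h5 + X 1 ω * h6 + X 2 ω * h7

/-- The coefficients expressing the four standard Gaussian variables in terms of
`a₁, a₂, b₁, b₂`. -/
noncomputable def cosineBasis (α : ℝ) : Fin 4 → Fin 4 → ℝ :=
  ![![Real.sin (2 * α) / Real.sin α, -1, 0, 0],
    ![-Real.cos (2 * α) / Real.sin α, Real.cos α / Real.sin α, 0, 0],
    ![0, 0, Real.sin (2 * α) / Real.sin α, -1],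
    ![0, 0, -Real.cos (2 * α) / Real.sin α, Real.cos α / Real.sin α]]

/-- Solving a_k = A cos kα + B sin kα at k = 1, 2 expresses A and B through a₁, a₂, and similarly
for b; this needs sin α ≠ 0. The four resulting variables are jointly Gaussian and orthonormal in
L², hence independent standard Gaussians. -/
theorem exists_standard_gaussian_of_cosine_correlation {α : ℝ} (hα : Real.sin α ≠ 0)
    {a b : ℕ → Ω → ℝ} (h : IsCosineCoefficients P α a b) :
    ∃ Z : Ω → Fin 4 → ℝ, AEMeasurable Z P ∧
      P.map Z = Measure.pi (fun _ => gaussianReal 0 1) ∧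
      ∀ᵐ ω ∂P, ∀ (n : ℕ) (t : ℝ),
        ∑ k ∈ Finset.Icc 1 n, (a k ω * Real.cos (k * t) + b k ω * Real.sin (k * t)) =
          ∑ i, cosineCurve α n t i * Z ω i := by
  have hP : IsProbabilityMeasure P := h.gaussian_a.isProbabilityMeasure
  set M := cosineBasis α with hM
  set W : Fin 4 → Ω → ℝ := ![a 1, a 2, b 1, b 2] with hW
  set Z : Ω → Fin 4 → ℝ := fun ω i => ∑ j, M i j * W j ω with hZ
  have hga1 : HasGaussianLaw (a 1) P := h.gaussian_a.hasGaussianLaw_eval 1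
  have hga2 : HasGaussianLaw (a 2) P := h.gaussian_a.hasGaussianLaw_eval 2
  have hgb1 : HasGaussianLaw (b 1) P := h.gaussian_b.hasGaussianLaw_eval 1
  have hgb2 : HasGaussianLaw (b 2) P := h.gaussian_b.hasGaussianLaw_eval 2
  have hga : HasGaussianLaw (fun ω => (a 1 ω, a 2 ω)) P :=
    h.gaussian_a.hasGaussianLaw_prodMk (s := 1) (t := 2)
  have hgb : HasGaussianLaw (fun ω => (b 1 ω, b 2 ω)) P :=
    h.gaussian_b.hasGaussianLaw_prodMk (s := 1) (t := 2)
  have hind : IndepFun (fun ω => (a 1 ω, a 2 ω)) (fun ω => (b 1 ω, b 2 ω)) P :=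
    h.indep.comp (φ := fun x : ℕ+ → ℝ => (x 1, x 2)) (ψ := fun x : ℕ+ → ℝ => (x 1, x 2))
      (by fun_prop) (by fun_prop)
  have hindk : ∀ k l : ℕ+, IndepFun (a k) (b l) P := fun k l =>
    h.indep.comp (φ := fun x : ℕ+ → ℝ => x k) (ψ := fun x : ℕ+ → ℝ => x l)
      (by fun_prop) (by fun_prop)
  -- Joint Gaussianity, needed for uncorrelated to imply independent, holds because Z is a linear
  -- image of two independent Gaussian pairs.
  have hZg : HasGaussianLaw Z P := by
    have hL := (IndepFun.hasGaussianLaw hga hgb hind).map_fun (ContinuousLinearMap.pi fun i =>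
      M i 0 • (ContinuousLinearMap.fst ℝ ℝ ℝ ∘L ContinuousLinearMap.fst ℝ (ℝ × ℝ) (ℝ × ℝ)) +
      M i 1 • (ContinuousLinearMap.snd ℝ ℝ ℝ ∘L ContinuousLinearMap.fst ℝ (ℝ × ℝ) (ℝ × ℝ)) +
      M i 2 • (ContinuousLinearMap.fst ℝ ℝ ℝ ∘L ContinuousLinearMap.snd ℝ (ℝ × ℝ) (ℝ × ℝ)) +
      M i 3 • (ContinuousLinearMap.snd ℝ ℝ ℝ ∘L ContinuousLinearMap.snd ℝ (ℝ × ℝ) (ℝ × ℝ)))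
    convert! hL using 1
    ext ω i
    simp [Z, W, Fin.sum_univ_four]
  have hWL : ∀ i, MemLp (W i) 2 P := fun i => by
    fin_cases i
    exacts [hga1.memLp_two, hga2.memLp_two, hgb1.memLp_two, hgb2.memLp_two]
  have hW0 : ∀ i, ∫ ω, W i ω ∂P = 0 := fun i => by
    fin_cases i
    exacts [h.mean_a 1, h.mean_a 2, h.mean_b 1, h.mean_b 2]
  have hcross : ∀ k l : ℕ+, ∫ ω, a k ω * b l ω ∂P = 0 := fun k l => by
    rw [(hindk k l).integral_fun_mul_eq_mul_integral
      (h.gaussian_a.aemeasurable k).aestronglyMeasurable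
      (h.gaussian_b.aemeasurable l).aestronglyMeasurable, h.mean_a, zero_mul]
  have hcross' : ∀ k l : ℕ+, ∫ ω, b l ω * a k ω ∂P = 0 := fun k l => by
    simp_rw [mul_comm (b _ _)]
    exact hcross k l
  have hZ0 : ∀ i, ∫ ω, Z ω i ∂P = 0 := fun i => by
    simp only [hZ]
    rw [integral_finsetSum _ fun j _ => ((hWL j).integrable (by norm_num)).const_mul _]
    simp [integral_const_mul, hW0]
  have hZZ : ∀ i j, ∫ ω, Z ω i * Z ω j ∂P = if i = j then 1 else 0 := by
    intro i j
    simp only [hZ]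
    rw [integral_sum_mul_sum _ _ fun k l => (hWL k).integrable_mul (hWL l)]
    have c11 := h.corr_a 1 1
    have c12 := h.corr_a 1 2
    have c21 := h.corr_a 2 1
    have c22 := h.corr_a 2 2
    have d11 := h.corr_b 1 1
    have d12 := h.corr_b 1 2
    have d21 := h.corr_b 2 1
    have d22 := h.corr_b 2 2
    have x11 := hcross 1 1
    have x12 := hcross 1 2
    have x21 := hcross 2 1
    have x22 := hcross 2 2
    have y11 := hcross' 1 1
    have y12 := hcross' 1 2
    have y21 := hcross' 2 1
    have y22 := hcross' 2 2
    have hs := Real.sin_sq_add_cos_sq α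
    have hs' : Real.cos α ^ 2 = 1 - Real.sin α ^ 2 := by linarith
    norm_num at c11 c12 c21 c22 d11 d12 d21 d22 x11 x12 x21 x22 y11 y12 y21 y22
    fin_cases i <;> fin_cases j <;>
      simp [Fin.sum_univ_four, W, M, cosineBasis, c11, c12, c21, c22, d11, d12, d21, d22,
        x11, x12, x21, x22, y11, y12, y21, y22, Real.sin_two_mul, Real.cos_two_mul] <;>
      field_simp <;> simp only [hs'] <;> ring_nf
  have hZL : ∀ i, MemLp (fun ω => Z ω i) 2 P := fun i => (hZg.eval i).memLp_two
  have hcov : ∀ i j, cov[fun ω => Z ω i, fun ω => Z ω j; P] = if i = j then 1 else 0 := by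
    intro i j
    rw [covariance_eq_sub (hZL i) (hZL j), hZ0, hZ0]
    simpa using hZZ i j
  have hiI : iIndepFun (fun i ω => Z ω i) P :=
    HasGaussianLaw.iIndepFun_of_covariance_eq_zero hZg fun i j hij => by
      rw [hcov, if_neg hij]
  refine ⟨Z, hZg.aemeasurable, ?_, ?_⟩
  · rw [(iIndepFun_iff_map_fun_eq_pi_map fun i => (hZg.eval i).aemeasurable).1 hiI]
    congr 1
    ext1 i
    rw [(hZg.eval i).map_eq_gaussianReal, hZ0, ← covariance_self (hZg.eval i).aemeasurable, hcov]
    simp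
  · have ha : ∀ᵐ ω ∂P, ∀ k : ℕ+, _ := ae_all_iff.2 fun k =>
      ae_eq_combination_of_cosine_correlation hα h.gaussian_a h.corr_a k
    have hb : ∀ᵐ ω ∂P, ∀ k : ℕ+, _ := ae_all_iff.2 fun k =>
      ae_eq_combination_of_cosine_correlation hα h.gaussian_b h.corr_b k
    filter_upwards [ha, hb] with ω hωa hωb n t
    simp only [Fin.sum_univ_four, cosineCurve, Matrix.cons_val, Finset.sum_mul,
      ← Finset.sum_add_distrib]
    refine Finset.sum_congr rfl fun k hk => ?_
    have ea := hωa ⟨k, (Finset.mem_Icc.1 hk).1⟩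
    have eb := hωb ⟨k, (Finset.mem_Icc.1 hk).1⟩
    simp only [PNat.mk_coe, PNat.val_ofNat] at ea eb
    rw [ea, eb]
    simp only [Z, W, M, cosineBasis, Fin.sum_univ_four, Matrix.cons_val]
    field_simp
    ring

/-- The derivative of `cosineCurve`. -/
noncomputable def cosineCurveDeriv (α : ℝ) (n : ℕ) (t : ℝ) : Fin 4 → ℝ :=
  ![∑ k ∈ Finset.Icc 1 n, Real.cos (k * α) * (-Real.sin (k * t) * k),
    ∑ k ∈ Finset.Icc 1 n, Real.sin (k * α) * (-Real.sin (k * t) * k),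
    ∑ k ∈ Finset.Icc 1 n, Real.cos (k * α) * (Real.cos (k * t) * k),
    ∑ k ∈ Finset.Icc 1 n, Real.sin (k * α) * (Real.cos (k * t) * k)]

theorem hasDerivAt_cosineCurve (α : ℝ) (n : ℕ) (t : ℝ) (i : Fin 4) :
    HasDerivAt (fun t => cosineCurve α n t i) (cosineCurveDeriv α n t i) t := by
  have hl : ∀ k : ℕ, HasDerivAt (fun t : ℝ => (k : ℝ) * t) k t := fun k => by
    simpa using (hasDerivAt_id t).const_mul (k : ℝ)
  fin_cases i
  · exact HasDerivAt.fun_sum (u := Finset.Icc 1 n) fun k _ => (hl k).cos.const_mul (Real.cos (k * α))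
  · exact HasDerivAt.fun_sum (u := Finset.Icc 1 n) fun k _ => (hl k).cos.const_mul (Real.sin (k * α))
  · exact HasDerivAt.fun_sum (u := Finset.Icc 1 n) fun k _ => (hl k).sin.const_mul (Real.cos (k * α))
  · exact HasDerivAt.fun_sum (u := Finset.Icc 1 n) fun k _ => (hl k).sin.const_mul (Real.sin (k * α))

theorem continuous_cosineCurve (α : ℝ) (n : ℕ) (i : Fin 4) :
    Continuous fun t => cosineCurve α n t i :=
  continuous_iff_continuousAt.2 fun t => (hasDerivAt_cosineCurve α n t i).continuousAt

theorem continuous_cosineCurveDeriv (α : ℝ) (n : ℕ) (i : Fin 4) :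
    Continuous fun t => cosineCurveDeriv α n t i := by
  fin_cases i <;> simp only [cosineCurveDeriv] <;> fun_prop

/-- The speed of the projection of `cosineCurve` to the unit sphere. -/
noncomputable def angularSpeed (α : ℝ) (n : ℕ) (t : ℝ) : ℝ :=
  √(∑ i, wedge (cosineCurve α n t) (cosineCurveDeriv α n t) i ^ 2) / ∑ i, cosineCurve α n t i ^ 2

theorem continuous_angularSpeed {α : ℝ} {n : ℕ} (h : ∀ t, 0 < ∑ i, cosineCurve α n t i ^ 2) :
    Continuous (angularSpeed α n) := by
  have hv := continuous_cosineCurve α n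
  have hw := continuous_cosineCurveDeriv α n
  refine Continuous.div (Real.continuous_sqrt.comp ?_)
    (continuous_finsetSum _ fun i _ => (hv i).pow 2) fun t => (h t).ne'
  refine continuous_finsetSum _ fun i _ => Continuous.pow ?_ 2
  fin_cases i <;> simp only [wedge] <;> simp <;> fun_prop

theorem lintegral_numZeros {α : ℝ} (hα : Real.sin α ≠ 0) {n : ℕ} (hn : n ≠ 0)
    (hv : ∀ t, 0 < ∑ i, cosineCurve α n t i ^ 2) {a b : ℕ → Ω → ℝ}
    (h : IsCosineCoefficients P α a b) :
    AEMeasurable (numZeros a b n) P ∧ ∫⁻ ω, numZeros a b n ω ∂P =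
      ENNReal.ofReal (∫ t in (0 : ℝ)..2 * Real.pi, angularSpeed α n t / Real.pi) := by
  obtain ⟨Z, hZm, hZ, hf⟩ := exists_standard_gaussian_of_cosine_correlation hα h
  obtain ⟨hm, hint⟩ := expected_zeros_of_gaussian_combination (hasDerivAt_cosineCurve α n)
    (continuous_cosineCurveDeriv α n) hv (measurableSet_Icc (a := 0) (b := 2 * Real.pi))
  rw [← hZ] at hm hint
  have hae : numZeros a b n =ᵐ[P] (fun z : Fin 4 → ℝ =>
      (({t ∈ Set.Icc 0 (2 * Real.pi) | ∑ i, cosineCurve α n t i * z i = 0}.encard : ℕ∞) :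
        ℝ≥0∞)) ∘ Z := by
    filter_upwards [hf] with ω hω
    have hn' : (0 : ℝ) < n := by positivity
    have : 1 / √(n : ℝ) ≠ 0 := by positivity
    simp only [numZeros, zeroCount, trigPoly, hω, Function.comp, mul_eq_zero, this, false_or]
  refine ⟨(hm.comp_aemeasurable hZm).congr hae.symm, ?_⟩
  rw [lintegral_congr_ae hae]
  simp only [Function.comp]
  rw [← lintegral_map' hm hZm, hint, intervalIntegral.integral_of_le (by positivity),
    ← integral_Icc_eq_integral_Ioc, ofReal_integral_eq_lintegral_ofReal]
  · exact lintegral_congr fun t => by rw [angularSpeed, div_div, mul_comm Real.pi]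
  · exact ((continuous_angularSpeed hv).div_const _).continuousOn.integrableOn_Icc
  · exact ae_of_all _ fun t => by
      have := (hv t).le
      exact div_nonneg (div_nonneg (Real.sqrt_nonneg _) this) Real.pi_pos.le

end CosineCoefficients

/-! ### Dirichlet sums and their derivatives -/

section DirichletSums

/-- `∑_{k=1}^n cos (k θ)`. -/
noncomputable def cosSum (n : ℕ) (θ : ℝ) : ℝ := ∑ k ∈ Finset.Icc 1 n, Real.cos (k * θ)

/-- `∑_{k=1}^n sin (k θ)`. -/
noncomputable def sinSum (n : ℕ) (θ : ℝ) : ℝ := ∑ k ∈ Finset.Icc 1 n, Real.sin (k * θ)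

/-- The derivative of `cosSum`. -/
noncomputable def cosSumDeriv (n : ℕ) (θ : ℝ) : ℝ :=
  ∑ k ∈ Finset.Icc 1 n, -Real.sin (k * θ) * k

/-- The derivative of `sinSum`. -/
noncomputable def sinSumDeriv (n : ℕ) (θ : ℝ) : ℝ :=
  ∑ k ∈ Finset.Icc 1 n, Real.cos (k * θ) * k

theorem hasDerivAt_cosSum (n : ℕ) (θ : ℝ) : HasDerivAt (cosSum n) (cosSumDeriv n θ) θ :=
  HasDerivAt.fun_sum (u := Finset.Icc 1 n) fun k _ => by
    simpa using ((hasDerivAt_id θ).const_mul (k : ℝ)).cos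

theorem hasDerivAt_sinSum (n : ℕ) (θ : ℝ) : HasDerivAt (sinSum n) (sinSumDeriv n θ) θ :=
  HasDerivAt.fun_sum (u := Finset.Icc 1 n) fun k _ => by
    simpa using ((hasDerivAt_id θ).const_mul (k : ℝ)).sin

theorem sin_half_mul_cosSum (n : ℕ) (θ : ℝ) :
    Real.sin (θ / 2) * cosSum n θ = Real.sin (n * θ / 2) * Real.cos ((n + 1) * θ / 2) := by
  induction n with
  | zero => simp [cosSum]
  | succ n ih =>
    have h : cosSum (n + 1) θ = cosSum n θ + Real.cos ((n + 1 : ℕ) * θ) := by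
      rw [cosSum, Finset.sum_Icc_succ_top (by omega)]; rfl
    rw [h, mul_add, ih]
    push_cast
    set A := ((n : ℝ) + 1) * θ / 2 with hA
    rw [show (n : ℝ) * θ / 2 = A - θ / 2 by rw [hA]; ring,
      show ((n : ℝ) + 1) * θ = 2 * A by rw [hA]; ring,
      show ((n : ℝ) + 1 + 1) * θ / 2 = A + θ / 2 by rw [hA]; ring, Real.sin_sub, Real.cos_two_mul,
      Real.cos_add]
    have h1 := Real.sin_sq_add_cos_sq A
    linear_combination Real.sin (θ / 2) * h1

theorem sin_half_mul_sinSum (n : ℕ) (θ : ℝ) :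
    Real.sin (θ / 2) * sinSum n θ = Real.sin (n * θ / 2) * Real.sin ((n + 1) * θ / 2) := by
  induction n with
  | zero => simp [sinSum]
  | succ n ih =>
    have h : sinSum (n + 1) θ = sinSum n θ + Real.sin ((n + 1 : ℕ) * θ) := by
      rw [sinSum, Finset.sum_Icc_succ_top (by omega)]; rfl
    rw [h, mul_add, ih]
    push_cast
    set A := ((n : ℝ) + 1) * θ / 2 with hA
    rw [show (n : ℝ) * θ / 2 = A - θ / 2 by rw [hA]; ring,
      show ((n : ℝ) + 1) * θ = 2 * A by rw [hA]; ring,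
      show ((n : ℝ) + 1 + 1) * θ / 2 = A + θ / 2 by rw [hA]; ring, Real.sin_sub, Real.sin_two_mul,
      Real.sin_add]
    ring

theorem sin_half_sq_mul_sums (n : ℕ) (θ : ℝ) :
    Real.sin (θ / 2) ^ 2 * (cosSum n θ ^ 2 + sinSum n θ ^ 2) = Real.sin (n * θ / 2) ^ 2 := by
  have h1 := sin_half_mul_cosSum n θ
  have h2 := sin_half_mul_sinSum n θ
  have h3 := Real.sin_sq_add_cos_sq ((n + 1) * θ / 2)
  calc _ = (Real.sin (θ / 2) * cosSum n θ) ^ 2 + (Real.sin (θ / 2) * sinSum n θ) ^ 2 := by ring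
    _ = _ := by rw [h1, h2]; linear_combination (Real.sin (n * θ / 2) ^ 2) * h3

/-- The derivative of the Dirichlet quotient `sin (n θ / 2) / sin (θ / 2)`. -/
noncomputable def dirichletDeriv (n : ℕ) (θ : ℝ) : ℝ :=
  (n / 2 * Real.cos (n * θ / 2) * Real.sin (θ / 2) - Real.sin (n * θ / 2) * Real.cos (θ / 2) / 2) /
    Real.sin (θ / 2) ^ 2

variable {n : ℕ} {θ : ℝ}

theorem hasDerivAt_mul_div_two (c x : ℝ) : HasDerivAt (fun x : ℝ => c * x / 2) (c / 2) x := by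
  simpa using ((hasDerivAt_id x).const_mul c).div_const 2

/-- Real part of the derivative of D(θ) e^{i(n+1)θ/2}, where D is the Dirichlet quotient. The
product identity, valid everywhere, is differentiated and then solved for the derivative of the sum.
-/
theorem cosSumDeriv_eq (h : Real.sin (θ / 2) ≠ 0) :
    cosSumDeriv n θ = dirichletDeriv n θ * Real.cos ((n + 1) * θ / 2) -
      (n + 1) / 2 * (Real.sin (n * θ / 2) / Real.sin (θ / 2)) * Real.sin ((n + 1) * θ / 2) := by
  have h0 : HasDerivAt (fun x : ℝ => x / 2) (1 / 2) θ := (hasDerivAt_id θ).div_const 2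
  have h1 := h0.sin.mul (hasDerivAt_cosSum n θ)
  have h2 := (hasDerivAt_mul_div_two (n : ℝ) θ).sin.mul
    (hasDerivAt_mul_div_two ((n : ℝ) + 1) θ).cos
  have h3 := h1.unique (h2.congr_of_eventuallyEq
    (Eventually.of_forall fun x => sin_half_mul_cosSum n x))
  have h4 : cosSum n θ = Real.sin (n * θ / 2) * Real.cos ((n + 1) * θ / 2) / Real.sin (θ / 2) := by
    rw [eq_div_iff h, mul_comm]; exact sin_half_mul_cosSum n θ
  rw [h4] at h3
  rw [dirichletDeriv]
  field_simp at h3 ⊢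
  linear_combination h3

theorem sinSumDeriv_eq (h : Real.sin (θ / 2) ≠ 0) :
    sinSumDeriv n θ = dirichletDeriv n θ * Real.sin ((n + 1) * θ / 2) +
      (n + 1) / 2 * (Real.sin (n * θ / 2) / Real.sin (θ / 2)) * Real.cos ((n + 1) * θ / 2) := by
  have h0 : HasDerivAt (fun x : ℝ => x / 2) (1 / 2) θ := (hasDerivAt_id θ).div_const 2
  have h1 := h0.sin.mul (hasDerivAt_sinSum n θ)
  have h2 := (hasDerivAt_mul_div_two (n : ℝ) θ).sin.mul
    (hasDerivAt_mul_div_two ((n : ℝ) + 1) θ).sin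
  have h3 := h1.unique (h2.congr_of_eventuallyEq
    (Eventually.of_forall fun x => sin_half_mul_sinSum n x))
  have h4 : sinSum n θ = Real.sin (n * θ / 2) * Real.sin ((n + 1) * θ / 2) / Real.sin (θ / 2) := by
    rw [eq_div_iff h, mul_comm]; exact sin_half_mul_sinSum n θ
  rw [h4] at h3
  rw [dirichletDeriv]
  field_simp at h3 ⊢
  linear_combination h3

/-- With z = D e^{i(n+1)θ/2} one has z' = (D' + i(n+1)D/2) e^{i(n+1)θ/2}; the common phase drops out
of |z|², |z'|² and Re(z̄ z'). -/
theorem dirichlet_quadratic_forms (h : Real.sin (θ / 2) ≠ 0) :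
    cosSum n θ ^ 2 + sinSum n θ ^ 2 = (Real.sin (n * θ / 2) / Real.sin (θ / 2)) ^ 2 ∧
    cosSumDeriv n θ ^ 2 + sinSumDeriv n θ ^ 2 = dirichletDeriv n θ ^ 2 +
      ((n + 1) / 2) ^ 2 * (Real.sin (n * θ / 2) / Real.sin (θ / 2)) ^ 2 ∧
    cosSum n θ * cosSumDeriv n θ + sinSum n θ * sinSumDeriv n θ =
      Real.sin (n * θ / 2) / Real.sin (θ / 2) * dirichletDeriv n θ := by
  have h1 : cosSum n θ = Real.sin (n * θ / 2) / Real.sin (θ / 2) * Real.cos ((n + 1) * θ / 2) := by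
    rw [div_mul_eq_mul_div, eq_div_iff h, mul_comm]; exact sin_half_mul_cosSum n θ
  have h2 : sinSum n θ = Real.sin (n * θ / 2) / Real.sin (θ / 2) * Real.sin ((n + 1) * θ / 2) := by
    rw [div_mul_eq_mul_div, eq_div_iff h, mul_comm]; exact sin_half_mul_sinSum n θ
  rw [cosSumDeriv_eq h, sinSumDeriv_eq h, h1, h2]
  set D := Real.sin (n * θ / 2) / Real.sin (θ / 2)
  set E := dirichletDeriv n θ
  have h3 := Real.sin_sq_add_cos_sq ((n + 1) * θ / 2)
  refine ⟨by linear_combination D ^ 2 * h3,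
    by linear_combination (E ^ 2 + ((n + 1) / 2) ^ 2 * D ^ 2) * h3,
    by linear_combination D * E * h3⟩

theorem abs_cosSumDeriv_le (n : ℕ) (θ : ℝ) : |cosSumDeriv n θ| ≤ (n : ℝ) ^ 2 := by
  refine (Finset.abs_sum_le_sum_abs _ _).trans ?_
  have : ∀ k ∈ Finset.Icc 1 n, |-Real.sin (k * θ) * (k : ℝ)| ≤ n := fun k hk => by
    rw [abs_mul, abs_neg, Nat.abs_cast]
    have h1 := Real.abs_sin_le_one (k * θ)
    have h2 : (k : ℝ) ≤ n := by exact_mod_cast (Finset.mem_Icc.1 hk).2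
    have h3 : (0 : ℝ) ≤ k := Nat.cast_nonneg k
    nlinarith [abs_nonneg (Real.sin (k * θ))]
  refine (Finset.sum_le_sum this).trans ?_
  simp [sq]

theorem abs_sinSumDeriv_le (n : ℕ) (θ : ℝ) : |sinSumDeriv n θ| ≤ (n : ℝ) ^ 2 := by
  refine (Finset.abs_sum_le_sum_abs _ _).trans ?_
  have : ∀ k ∈ Finset.Icc 1 n, |Real.cos (k * θ) * (k : ℝ)| ≤ n := fun k hk => by
    rw [abs_mul, Nat.abs_cast]
    have h1 := Real.abs_cos_le_one (k * θ)
    have h2 : (k : ℝ) ≤ n := by exact_mod_cast (Finset.mem_Icc.1 hk).2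
    have h3 : (0 : ℝ) ≤ k := Nat.cast_nonneg k
    nlinarith [abs_nonneg (Real.cos (k * θ))]
  refine (Finset.sum_le_sum this).trans ?_
  simp [sq]

theorem abs_sin_nat_mul_le (k : ℕ) (x : ℝ) : |Real.sin (k * x)| ≤ k * |Real.sin x| := by
  induction k with
  | zero => simp
  | succ k ih =>
    push_cast
    rw [add_mul, one_mul, Real.sin_add]
    have h1 := Real.abs_cos_le_one x
    have h2 := Real.abs_cos_le_one (k * x)
    calc _ ≤ |Real.sin (k * x) * Real.cos x| + |Real.cos (k * x) * Real.sin x| := abs_add_le _ _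
      _ ≤ |Real.sin (k * x)| * 1 + 1 * |Real.sin x| := by
        rw [abs_mul, abs_mul]; gcongr
      _ ≤ _ := by linarith

/-- Here |sin(kθ/2)| ≤ k |sin(θ/2)| ≤ 1/2 for all k ≤ n, so every term of the sum is at least 1/2.
-/
theorem half_le_cosSum (h : |Real.sin (θ / 2)| ≤ 1 / (2 * n)) : (n : ℝ) / 2 ≤ cosSum n θ := by
  rcases Nat.eq_zero_or_pos n with rfl | hn
  · simp [cosSum]
  have hn' : (0 : ℝ) < n := by exact_mod_cast hn
  have : ∀ k ∈ Finset.Icc 1 n, (1 : ℝ) / 2 ≤ Real.cos (k * θ) := fun k hk => by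
    have h1 := abs_sin_nat_mul_le k (θ / 2)
    have h2 : (k : ℝ) ≤ n := by exact_mod_cast (Finset.mem_Icc.1 hk).2
    have h3 : |Real.sin (k * (θ / 2))| ≤ 1 / 2 := by
      refine h1.trans ((mul_le_mul h2 h (abs_nonneg _) hn'.le).trans (le_of_eq ?_))
      field_simp
    have h4 : Real.cos (k * θ) = 1 - 2 * Real.sin (k * (θ / 2)) ^ 2 := by
      rw [show (k : ℝ) * θ = 2 * (k * (θ / 2)) by ring, Real.cos_two_mul, Real.cos_sq']; ring
    have h5 : Real.sin (k * (θ / 2)) ^ 2 ≤ (1 / 2) ^ 2 := sq_le_sq' (abs_le.1 h3).1 (abs_le.1 h3).2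
    linarith
  have h6 := Finset.card_nsmul_le_sum _ _ _ this
  simp only [Nat.card_Icc, Nat.add_sub_cancel, nsmul_eq_mul] at h6
  rw [cosSum]
  linarith

end DirichletSums

/-! ### Closed form of the angular speed -/

section AngularSpeed

variable {α : ℝ} {n : ℕ}

/-- Up to an orthogonal change of coordinates and the factor 1/√2, the curve is the pair of
Dirichlet sums at t - α and t + α, so its quadratic forms decouple. -/
theorem cosineCurve_eq (α : ℝ) (n : ℕ) (t : ℝ) : cosineCurve α n t =
    ![(cosSum n (t - α) + cosSum n (t + α)) / 2, (sinSum n (t + α) - sinSum n (t - α)) / 2,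
      (sinSum n (t + α) + sinSum n (t - α)) / 2, (cosSum n (t - α) - cosSum n (t + α)) / 2] := by
  ext i
  fin_cases i <;> simp only [cosineCurve, cosSum, sinSum, ← Finset.sum_add_distrib,
    ← Finset.sum_sub_distrib, Finset.sum_div, Fin.zero_eta, Fin.mk_one, Fin.reduceFinMk,
    Matrix.cons_val] <;>
    refine Finset.sum_congr rfl fun k _ => ?_ <;>
    simp only [mul_add, mul_sub, Real.cos_add, Real.cos_sub, Real.sin_add, Real.sin_sub] <;> ring

theorem cosineCurveDeriv_eq (α : ℝ) (n : ℕ) (t : ℝ) : cosineCurveDeriv α n t =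
    ![(cosSumDeriv n (t - α) + cosSumDeriv n (t + α)) / 2,
      (sinSumDeriv n (t + α) - sinSumDeriv n (t - α)) / 2,
      (sinSumDeriv n (t + α) + sinSumDeriv n (t - α)) / 2,
      (cosSumDeriv n (t - α) - cosSumDeriv n (t + α)) / 2] := by
  ext i
  fin_cases i <;> simp only [cosineCurveDeriv, cosSumDeriv, sinSumDeriv,
    ← Finset.sum_add_distrib, ← Finset.sum_sub_distrib, Finset.sum_div, Fin.zero_eta, Fin.mk_one,
    Fin.reduceFinMk, Matrix.cons_val] <;>
    refine Finset.sum_congr rfl fun k _ => ?_ <;>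
    simp only [mul_add, mul_sub, Real.cos_add, Real.cos_sub, Real.sin_add, Real.sin_sub] <;> ring

theorem sum_cosineCurve_sq (α : ℝ) (n : ℕ) (t : ℝ) : ∑ i, cosineCurve α n t i ^ 2 =
    ((cosSum n (t - α) ^ 2 + sinSum n (t - α) ^ 2) +
      (cosSum n (t + α) ^ 2 + sinSum n (t + α) ^ 2)) / 2 := by
  rw [cosineCurve_eq]
  simp only [Fin.sum_univ_four, Matrix.cons_val]
  ring

theorem sum_wedge_cosineCurve_sq (α : ℝ) (n : ℕ) (t : ℝ) :
    ∑ i, wedge (cosineCurve α n t) (cosineCurveDeriv α n t) i ^ 2 =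
      (((cosSum n (t - α) ^ 2 + sinSum n (t - α) ^ 2) +
        (cosSum n (t + α) ^ 2 + sinSum n (t + α) ^ 2)) *
      ((cosSumDeriv n (t - α) ^ 2 + sinSumDeriv n (t - α) ^ 2) +
        (cosSumDeriv n (t + α) ^ 2 + sinSumDeriv n (t + α) ^ 2)) -
      ((cosSum n (t - α) * cosSumDeriv n (t - α) + sinSum n (t - α) * sinSumDeriv n (t - α)) +
        (cosSum n (t + α) * cosSumDeriv n (t + α) +
          sinSum n (t + α) * sinSumDeriv n (t + α))) ^ 2) / 4 := by
  rw [sum_wedge_sq, cosineCurve_eq, cosineCurveDeriv_eq]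
  simp only [Fin.sum_univ_four, Matrix.cons_val]
  ring

/-- If both Dirichlet sums vanish at t, then sin(n(t ± α)/2) = 0, and subtracting the two angles
gives sin nα = 0. -/
theorem sum_cosineCurve_sq_pos (h : Real.sin (n * α) ≠ 0) (t : ℝ) :
    0 < ∑ i, cosineCurve α n t i ^ 2 := by
  refine lt_of_le_of_ne (Finset.sum_nonneg fun i _ => sq_nonneg _) fun h0 => h ?_
  rw [sum_cosineCurve_sq] at h0
  have h1 := sin_half_sq_mul_sums n (t - α)
  have h2 := sin_half_sq_mul_sums n (t + α)
  have e1 : cosSum n (t - α) ^ 2 + sinSum n (t - α) ^ 2 = 0 := by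
    nlinarith [sq_nonneg (cosSum n (t - α)), sq_nonneg (sinSum n (t - α)),
      sq_nonneg (cosSum n (t + α)), sq_nonneg (sinSum n (t + α))]
  have e2 : cosSum n (t + α) ^ 2 + sinSum n (t + α) ^ 2 = 0 := by
    nlinarith [sq_nonneg (cosSum n (t - α)), sq_nonneg (sinSum n (t - α)),
      sq_nonneg (cosSum n (t + α)), sq_nonneg (sinSum n (t + α))]
  rw [e1, mul_zero] at h1
  rw [e2, mul_zero] at h2
  have h3 := pow_eq_zero_iff (two_ne_zero) |>.1 h1.symm
  have h4 := pow_eq_zero_iff (two_ne_zero) |>.1 h2.symm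
  rw [show (n : ℝ) * α = n * (t + α) / 2 - n * (t - α) / 2 by ring, Real.sin_sub, h3, h4]
  ring

/-- The angular speed is at most |v'|/|v|. In this window one of the two sums is at least n/2, while
the derivatives are trivially at most n². -/
theorem angularSpeed_le_of_near {t : ℝ}
    (h : |Real.sin ((t + α) / 2)| ≤ 1 / (2 * n) ∨ |Real.sin ((t - α) / 2)| ≤ 1 / (2 * n)) :
    angularSpeed α n t ≤ 4 * n := by
  rcases Nat.eq_zero_or_pos n with rfl | hn
  · simp [angularSpeed, sum_cosineCurve_sq, cosSum, sinSum]
  have hn' : (0 : ℝ) < n := by exact_mod_cast hn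
  rw [angularSpeed, sum_wedge_cosineCurve_sq, sum_cosineCurve_sq]
  set N := (cosSum n (t - α) ^ 2 + sinSum n (t - α) ^ 2) +
    (cosSum n (t + α) ^ 2 + sinSum n (t + α) ^ 2)
  have hN : (n : ℝ) ^ 2 / 4 ≤ N := by
    have key : ∀ θ : ℝ, |Real.sin (θ / 2)| ≤ 1 / (2 * n) →
        (n : ℝ) ^ 2 / 4 ≤ cosSum n θ ^ 2 + sinSum n θ ^ 2 := fun θ hθ => by
      nlinarith [half_le_cosSum hθ, sq_nonneg (sinSum n θ)]
    rcases h with h | h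
    · have := key _ h
      nlinarith [sq_nonneg (cosSum n (t - α)), sq_nonneg (sinSum n (t - α))]
    · have := key _ h
      nlinarith [sq_nonneg (cosSum n (t + α)), sq_nonneg (sinSum n (t + α))]
  have hN0 : 0 < N := lt_of_lt_of_le (by positivity) hN
  set N' := (cosSumDeriv n (t - α) ^ 2 + sinSumDeriv n (t - α) ^ 2) +
    (cosSumDeriv n (t + α) ^ 2 + sinSumDeriv n (t + α) ^ 2)
  have hN' : N' ≤ 4 * (n : ℝ) ^ 4 := by
    have key1 : ∀ θ : ℝ, cosSumDeriv n θ ^ 2 ≤ ((n : ℝ) ^ 2) ^ 2 := fun θ =>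
      sq_le_sq' (abs_le.1 (abs_cosSumDeriv_le n θ)).1 (abs_le.1 (abs_cosSumDeriv_le n θ)).2
    have key2 : ∀ θ : ℝ, sinSumDeriv n θ ^ 2 ≤ ((n : ℝ) ^ 2) ^ 2 := fun θ =>
      sq_le_sq' (abs_le.1 (abs_sinSumDeriv_le n θ)).1 (abs_le.1 (abs_sinSumDeriv_le n θ)).2
    have := key1 (t - α)
    have := key1 (t + α)
    have := key2 (t - α)
    have := key2 (t + α)
    nlinarith
  rw [div_le_iff₀ (by positivity)]
  refine Real.sqrt_le_iff.2 ⟨by positivity, ?_⟩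
  set M := (cosSum n (t - α) * cosSumDeriv n (t - α) + sinSum n (t - α) * sinSumDeriv n (t - α)) +
        (cosSum n (t + α) * cosSumDeriv n (t + α) + sinSum n (t + α) * sinSumDeriv n (t + α))
  have h1 : N * N' ≤ N * (4 * (n : ℝ) ^ 4) := by gcongr
  have h2 : (n : ℝ) ^ 2 * (n ^ 2 / 4) ≤ n ^ 2 * N := by gcongr
  have h3 : N * ((n : ℝ) ^ 4) ≤ N * (4 * (n ^ 2 * N)) := by
    gcongr
    linarith
  nlinarith [sq_nonneg M]

theorem abs_sqrt_sq_add_sq_sub_le (x y x' y' : ℝ) :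
    |√(x ^ 2 + y ^ 2) - √(x' ^ 2 + y' ^ 2)| ≤ |x - x'| + |y - y'| := by
  have h := abs_norm_sub_norm_le ((x : ℂ) + y * Complex.I) (x' + y' * Complex.I)
  rw [Complex.norm_add_mul_I, Complex.norm_add_mul_I] at h
  refine h.trans ((Complex.norm_le_abs_re_add_abs_im _).trans (le_of_eq ?_))
  simp

/-- Lagrange's identity gives speed² = ((n+1)/2)² + (W/N)², with W the Wronskian of the two
Dirichlet quotients and N the sum of their squares. Differentiating the fast sines in W produces
-(n/2)g; differentiating the slow ones leaves a multiple of sin α. The term 1/2 is (n+1)/2 - n/2. -/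
theorem abs_angularSpeed_sub_le (hn : Real.sin (n * α) ≠ 0) {t : ℝ}
    (ha : Real.sin ((t + α) / 2) ≠ 0) (hb : Real.sin ((t - α) / 2) ≠ 0) :
    |angularSpeed α n t - n / 2 * √(1 + gFun α (n * α) t (n * t) ^ 2)| ≤
      1 / 2 + |Real.sin α| / (4 * |Real.sin ((t + α) / 2) * Real.sin ((t - α) / 2)|) := by
  have hpos := sum_cosineCurve_sq_pos hn t
  obtain ⟨p1, p2, p3⟩ := dirichlet_quadratic_forms (n := n) hb
  obtain ⟨q1, q2, q3⟩ := dirichlet_quadratic_forms (n := n) ha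
  rw [sum_cosineCurve_sq, p1, q1] at hpos
  rw [angularSpeed, sum_wedge_cosineCurve_sq, sum_cosineCurve_sq, p1, p2, p3, q1, q2, q3]
  have hd1 : dirichletDeriv n (t - α) = (n / 2 * Real.cos (n * (t - α) / 2) *
    Real.sin ((t - α) / 2) - Real.sin (n * (t - α) / 2) * Real.cos ((t - α) / 2) / 2) /
      Real.sin ((t - α) / 2) ^ 2 := rfl
  have hd2 : dirichletDeriv n (t + α) = (n / 2 * Real.cos (n * (t + α) / 2) *
    Real.sin ((t + α) / 2) - Real.sin (n * (t + α) / 2) * Real.cos ((t + α) / 2) / 2) /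
      Real.sin ((t + α) / 2) ^ 2 := rfl
  have hg : gFun α (n * α) t (n * t) = Real.sin (n * α) * Real.sin ((t - α) / 2) *
      Real.sin ((t + α) / 2) / (Real.sin (n * (t - α) / 2) ^ 2 * Real.sin ((t + α) / 2) ^ 2 +
        Real.sin (n * (t + α) / 2) ^ 2 * Real.sin ((t - α) / 2) ^ 2) := by
    rw [gFun, ← mul_sub, ← mul_add]
  have hsn : Real.sin (n * α) = Real.sin (n * (t + α) / 2) * Real.cos (n * (t - α) / 2) -
      Real.cos (n * (t + α) / 2) * Real.sin (n * (t - α) / 2) := by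
    rw [← Real.sin_sub]; congr 1; ring
  have hs : Real.sin α = Real.sin ((t + α) / 2) * Real.cos ((t - α) / 2) -
      Real.cos ((t + α) / 2) * Real.sin ((t - α) / 2) := by
    rw [← Real.sin_sub]; congr 1; ring
  set a := Real.sin ((t + α) / 2)
  set b := Real.sin ((t - α) / 2)
  set A := Real.sin (n * (t - α) / 2)
  set B := Real.sin (n * (t + α) / 2)
  set D1 := dirichletDeriv n (t - α)
  set D2 := dirichletDeriv n (t + α)
  set G := gFun α (n * α) t (n * t)
  set N := (A / b) ^ 2 + (B / a) ^ 2 with hN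
  have hN0 : 0 < N := by linarith
  have hden : 0 < A ^ 2 * a ^ 2 + B ^ 2 * b ^ 2 := by
    have : A ^ 2 * a ^ 2 + B ^ 2 * b ^ 2 = N * (a * b) ^ 2 := by rw [hN]; field_simp
    rw [this]
    have : a * b ≠ 0 := mul_ne_zero ha hb
    positivity
  set W := A / b * D2 - B / a * D1 with hW
  have hWN : W / N = -(n / 2 * G) + A * B * Real.sin α / (2 * (A ^ 2 * a ^ 2 + B ^ 2 * b ^ 2)) := by
    have h1 : N = (A ^ 2 * a ^ 2 + B ^ 2 * b ^ 2) / (a * b) ^ 2 := by rw [hN]; field_simp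
    have h2 : W = (-(n * Real.sin (n * α) * a * b) + A * B * Real.sin α) / (2 * (a * b) ^ 2) := by
      rw [hW, hd1, hd2, hsn, hs]
      field_simp
      ring
    rw [h1, h2, hg]
    have := hden.ne'
    field_simp
  have hspeed : √((N * (D1 ^ 2 + ((n + 1) / 2) ^ 2 * (A / b) ^ 2 +
      (D2 ^ 2 + ((n + 1) / 2) ^ 2 * (B / a) ^ 2)) - (A / b * D1 + B / a * D2) ^ 2) / 4) / (N / 2) =
      √((((n : ℝ) + 1) / 2) ^ 2 + (W / N) ^ 2) := by
    have hw : W / N * N = W := div_mul_cancel₀ _ hN0.ne'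
    have h1 : (N * (D1 ^ 2 + ((n + 1) / 2) ^ 2 * (A / b) ^ 2 +
        (D2 ^ 2 + ((n + 1) / 2) ^ 2 * (B / a) ^ 2)) - (A / b * D1 + B / a * D2) ^ 2) / 4 =
        ((((n : ℝ) + 1) / 2) ^ 2 + (W / N) ^ 2) * (N / 2) ^ 2 := by
      rw [show ((((n : ℝ) + 1) / 2) ^ 2 + (W / N) ^ 2) * (N / 2) ^ 2 =
        ((((n : ℝ) + 1) / 2) ^ 2 * N ^ 2 + (W / N * N) ^ 2) / 4 by ring, hw, hW, hN]
      generalize A / b = x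
      generalize B / a = y
      ring
    rw [h1, Real.sqrt_mul (by positivity), Real.sqrt_sq hpos.le, mul_div_cancel_right₀ _ hpos.ne']
  rw [hspeed]
  have hG : (n : ℝ) / 2 * √(1 + G ^ 2) = √(((n : ℝ) / 2) ^ 2 + (-(n / 2 * G)) ^ 2) := by
    rw [show ((n : ℝ) / 2) ^ 2 + (-(n / 2 * G)) ^ 2 = (n / 2) ^ 2 * (1 + G ^ 2) by ring,
      Real.sqrt_mul (sq_nonneg _), Real.sqrt_sq (by positivity)]
  rw [hG]
  refine (abs_sqrt_sq_add_sq_sub_le _ _ _ _).trans (add_le_add ?_ ?_)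
  · rw [show ((n : ℝ) + 1) / 2 - n / 2 = 1 / 2 by ring, abs_of_pos (by norm_num)]
  · rw [hWN, add_sub_cancel_left, abs_div, abs_mul, abs_of_pos (a := 2 * _) (by positivity),
      div_le_div_iff₀ (by positivity) (by positivity)]
    -- AM–GM on the denominator removes the fast factors A and B from the error.
    have h4 : 2 * (|A * B| * |a * b|) ≤ A ^ 2 * a ^ 2 + B ^ 2 * b ^ 2 := by
      have := two_mul_le_add_sq (|A| * |a|) (|B| * |b|)
      rw [mul_pow, mul_pow, sq_abs, sq_abs, sq_abs, sq_abs] at this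
      rw [abs_mul, abs_mul]
      linarith
    calc |A * B| * |Real.sin α| * (4 * |a * b|) =
          |Real.sin α| * (2 * (2 * (|A * B| * |a * b|))) := by ring
      _ ≤ _ := by gcongr

end AngularSpeed

/-! ### Poisson-type kernel: primitive, mass and comparisons -/

section PoissonKernel

/-- The function `gFun` in terms of `a = sin ((s + α) / 2)` and `b = sin ((s - α) / 2)`. -/
noncomputable def poissonQuotient (x a b u : ℝ) : ℝ :=
  Real.sin x * b * a / (Real.sin ((u - x) / 2) ^ 2 * a ^ 2 + Real.sin ((u + x) / 2) ^ 2 * b ^ 2)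

theorem gFun_eq_poissonQuotient (α x s u : ℝ) :
    gFun α x s u = poissonQuotient x (Real.sin ((s + α) / 2)) (Real.sin ((s - α) / 2)) u := rfl

variable {x a b u : ℝ}

theorem poissonQuotient_denom_pos (hx : Real.sin x ≠ 0) (ha : a ≠ 0) (hb : b ≠ 0) (u : ℝ) :
    0 < Real.sin ((u - x) / 2) ^ 2 * a ^ 2 + Real.sin ((u + x) / 2) ^ 2 * b ^ 2 := by
  refine lt_of_le_of_ne (by positivity) fun h => hx ?_
  have h1 : (Real.sin ((u - x) / 2) * a) ^ 2 = 0 := by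
    nlinarith [sq_nonneg (Real.sin ((u - x) / 2) * a), sq_nonneg (Real.sin ((u + x) / 2) * b)]
  have h2 : (Real.sin ((u + x) / 2) * b) ^ 2 = 0 := by
    nlinarith [sq_nonneg (Real.sin ((u - x) / 2) * a), sq_nonneg (Real.sin ((u + x) / 2) * b)]
  have h3 : Real.sin ((u - x) / 2) = 0 := by simpa [ha] using h1
  have h4 : Real.sin ((u + x) / 2) = 0 := by simpa [hb] using h2
  rw [show x = (u + x) / 2 - (u - x) / 2 by ring, Real.sin_sub, h3, h4]
  ring

theorem continuous_poissonQuotient (hx : Real.sin x ≠ 0) (ha : a ≠ 0) (hb : b ≠ 0) :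
    Continuous (poissonQuotient x a b) := by
  unfold poissonQuotient
  exact Continuous.div (by fun_prop) (by fun_prop)
    fun u => (poissonQuotient_denom_pos hx ha hb u).ne'

theorem sin_half_sq_periodic (c : ℝ) :
    Function.Periodic (fun u => Real.sin ((u + c) / 2) ^ 2) (2 * Real.pi) := fun u => by
  simp only
  rw [show (u + 2 * Real.pi + c) / 2 = (u + c) / 2 + Real.pi by ring, Real.sin_add_pi, neg_sq]

theorem poissonQuotient_periodic (x a b : ℝ) :
    Function.Periodic (poissonQuotient x a b) (2 * Real.pi) := fun u => by
  have h1 := sin_half_sq_periodic x u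
  have h2 := sin_half_sq_periodic (-x) u
  simp only [← sub_eq_add_neg] at h1 h2
  rw [poissonQuotient, h1, h2, poissonQuotient]

theorem hasDerivAt_two_mul_arctan (ha : a ≠ 0) (hb : b ≠ 0)
    (hu : Real.sin ((u + x) / 2) ≠ 0) :
    HasDerivAt (fun u => 2 * Real.arctan
      (a * Real.sin ((u - x) / 2) / (b * Real.sin ((u + x) / 2)))) (poissonQuotient x a b u) u := by
  have h1 : HasDerivAt (fun u : ℝ => (u - x) / 2) (1 / 2) u :=
    ((hasDerivAt_id u).sub_const x).div_const 2
  have h2 : HasDerivAt (fun u : ℝ => (u + x) / 2) (1 / 2) u :=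
    ((hasDerivAt_id u).add_const x).div_const 2
  have h3 := (((h1.sin.const_mul a).div (h2.sin.const_mul b) (mul_ne_zero hb hu)).arctan).const_mul 2
  refine h3.congr_deriv ?_
  rw [poissonQuotient]
  simp only [Pi.div_apply]
  have hs : Real.sin x = Real.sin ((u + x) / 2) * Real.cos ((u - x) / 2) -
      Real.cos ((u + x) / 2) * Real.sin ((u - x) / 2) := by
    rw [← Real.sin_sub]; congr 1; ring
  rw [hs]
  set S := Real.sin ((u + x) / 2)
  set R := Real.sin ((u - x) / 2)
  have hd : 0 < R ^ 2 * a ^ 2 + S ^ 2 * b ^ 2 := by positivity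
  have hd' : 0 < 1 + (a * R / (b * S)) ^ 2 := by positivity
  field_simp
  ring

/-- The kernel has constant sign and is the derivative of 2 arctan of a function whose only pole per
period is at u = -x. Its mass over a period is thus at most the length 2π of the range of 2 arctan,
uniformly in x, a and b. -/
theorem integral_abs_poissonQuotient_le (hx : Real.sin x ≠ 0) (ha : a ≠ 0) (hb : b ≠ 0) :
    ∫ u in (0 : ℝ)..2 * Real.pi, |poissonQuotient x a b u| ≤ 2 * Real.pi := by
  have hc := continuous_poissonQuotient hx ha hb
  have hpi := Real.pi_pos
  have hper := ((poissonQuotient_periodic x a b).comp fun y => |y|).intervalIntegral_add_eq 0 (-x)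
  simp only [Function.comp, zero_add] at hper
  rw [hper]
  set k := |Real.sin x * b * a| / (Real.sin x * b * a) with hk
  have hc0 : Real.sin x * b * a ≠ 0 := mul_ne_zero (mul_ne_zero hx hb) ha
  have hk1 : |k| = 1 := by rw [hk, abs_div, abs_abs, div_self (abs_ne_zero.2 hc0)]
  have hsign : ∀ u, |poissonQuotient x a b u| = k * poissonQuotient x a b u := fun u => by
    rw [poissonQuotient, abs_div, abs_of_pos (poissonQuotient_denom_pos hx ha hb u), hk]
    field_simp
  -- The period is started at the pole -x and trimmed by δ at both ends, so that the primitive is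
  -- differentiable on the whole closed interval.
  have hpart : ∀ δ ∈ Set.Ioo 0 Real.pi,
      ∫ u in (-x + δ)..(-x + 2 * Real.pi - δ), |poissonQuotient x a b u| ≤ 2 * Real.pi := by
    rintro δ ⟨hδ, hδ'⟩
    have hFTC := intervalIntegral.integral_eq_sub_of_hasDerivAt (a := -x + δ)
      (b := -x + 2 * Real.pi - δ) (f := fun u => 2 * Real.arctan
      (a * Real.sin ((u - x) / 2) / (b * Real.sin ((u + x) / 2)))) (f' := poissonQuotient x a b)
      (fun u hu => hasDerivAt_two_mul_arctan ha hb (by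
        rw [Set.uIcc_of_le (by linarith)] at hu
        exact (Real.sin_pos_of_pos_of_lt_pi (by linarith [hu.1]) (by linarith [hu.2])).ne'))
      (hc.intervalIntegrable _ _)
    simp_rw [hsign]
    rw [intervalIntegral.integral_const_mul, hFTC]
    refine (le_abs_self _).trans ?_
    rw [abs_mul, hk1, one_mul, abs_le]
    constructor <;>
    linarith [Real.arctan_lt_pi_div_two (a * Real.sin ((-x + δ - x) / 2) /
        (b * Real.sin ((-x + δ + x) / 2))), Real.neg_pi_div_two_lt_arctan
        (a * Real.sin ((-x + δ - x) / 2) / (b * Real.sin ((-x + δ + x) / 2))),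
        Real.arctan_lt_pi_div_two (a * Real.sin ((-x + 2 * Real.pi - δ - x) / 2) /
        (b * Real.sin ((-x + 2 * Real.pi - δ + x) / 2))), Real.neg_pi_div_two_lt_arctan
        (a * Real.sin ((-x + 2 * Real.pi - δ - x) / 2) /
          (b * Real.sin ((-x + 2 * Real.pi - δ + x) / 2)))]
  have hint : ∀ p q, IntervalIntegrable (fun u => |poissonQuotient x a b u|) volume p q :=
    fun p q => hc.abs.intervalIntegrable p q
  have hprim := intervalIntegral.continuous_primitive hint 0
  have hlim : Tendsto (fun δ : ℝ =>
      ∫ u in (-x + δ)..(-x + 2 * Real.pi - δ), |poissonQuotient x a b u|) (𝓝[>] 0)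
      (𝓝 (∫ u in (-x)..(-x + 2 * Real.pi), |poissonQuotient x a b u|)) := by
    have : Continuous fun δ : ℝ =>
        ∫ u in (-x + δ)..(-x + 2 * Real.pi - δ), |poissonQuotient x a b u| := by
      have h : ∀ δ : ℝ, ∫ u in (-x + δ)..(-x + 2 * Real.pi - δ), |poissonQuotient x a b u| =
          (∫ u in (0 : ℝ)..(-x + 2 * Real.pi - δ), |poissonQuotient x a b u|) -
          ∫ u in (0 : ℝ)..(-x + δ), |poissonQuotient x a b u| := fun δ =>
        (intervalIntegral.integral_interval_sub_left (hint _ _) (hint _ _)).symm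
      simp_rw [h]
      exact (hprim.comp (by fun_prop)).sub (hprim.comp (by fun_prop))
    simpa using (this.tendsto 0).mono_left nhdsWithin_le_nhds
  refine le_of_tendsto hlim ?_
  filter_upwards [Ioo_mem_nhdsGT hpi] with δ hδ using hpart δ hδ

/-- The difference factors exactly through the cross term b'a - ba'; the other numerator factor is
bounded by a multiple of the new denominator D', which cancels. -/
theorem abs_poissonQuotient_sub_le {a' b' : ℝ} (hx : Real.sin x ≠ 0) (ha : a ≠ 0) (hb : b ≠ 0)
    (ha' : a' ≠ 0) (hb' : b' ≠ 0) (u : ℝ) :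
    |poissonQuotient x a' b' u - poissonQuotient x a b u| ≤
      |poissonQuotient x a b u| * (|b' * a - b * a'| * (1 / |a' * b| + 1 / |a * b'|)) := by
  have hD := poissonQuotient_denom_pos hx ha hb u
  have hD' := poissonQuotient_denom_pos hx ha' hb' u
  unfold poissonQuotient
  set A := Real.sin ((u - x) / 2)
  set B := Real.sin ((u + x) / 2)
  set D := A ^ 2 * a ^ 2 + B ^ 2 * b ^ 2 with hDdef
  set D' := A ^ 2 * a' ^ 2 + B ^ 2 * b' ^ 2 with hD'def
  have e1 : Real.sin x * b' * a' / D' - Real.sin x * b * a / D =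
      Real.sin x * (b' * a - b * a') * (A ^ 2 * a * a' - B ^ 2 * b * b') / (D * D') := by
    rw [div_sub_div _ _ hD'.ne' hD.ne', mul_comm D' D, hDdef, hD'def]
    ring
  have e2 : |A ^ 2 * a * a' - B ^ 2 * b * b'| ≤ D' * (|a| / |a'| + |b| / |b'|) := by
    have p1 := abs_pos.2 ha'
    have p2 := abs_pos.2 hb'
    have h1 : A ^ 2 * a' ^ 2 ≤ D' := by rw [hD'def]; nlinarith [sq_nonneg (B * b')]
    have h2 : B ^ 2 * b' ^ 2 ≤ D' := by rw [hD'def]; nlinarith [sq_nonneg (A * a')]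
    calc |A ^ 2 * a * a' - B ^ 2 * b * b'| ≤ |A ^ 2 * a * a'| + |B ^ 2 * b * b'| := abs_sub _ _
      _ = A ^ 2 * |a'| ^ 2 * (|a| / |a'|) + B ^ 2 * |b'| ^ 2 * (|b| / |b'|) := by
        simp only [abs_mul, abs_pow, sq_abs]
        rw [← sq_abs a', ← sq_abs b']
        field_simp
      _ ≤ D' * (|a| / |a'|) + D' * (|b| / |b'|) := by
        rw [sq_abs, sq_abs]; gcongr
      _ = _ := by ring
  rw [e1, abs_div, abs_mul, abs_mul, abs_div, abs_of_pos (mul_pos hD hD'), abs_of_pos hD]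
  have p1 := abs_pos.2 ha
  have p2 := abs_pos.2 hb
  have p3 := abs_pos.2 ha'
  have p4 := abs_pos.2 hb'
  calc |Real.sin x| * |b' * a - b * a'| * |A ^ 2 * a * a' - B ^ 2 * b * b'| / (D * D')
      ≤ |Real.sin x| * |b' * a - b * a'| * (D' * (|a| / |a'| + |b| / |b'|)) / (D * D') := by
        gcongr
    _ = _ := by
        simp only [abs_mul]
        field_simp

/-- When a is of order 1/N and b of order 1, the kernel is dominated by the one with parameters (1,
N). These do not depend on the slow variable, so the bound can still be integrated over u when a and
b vary with u. -/
theorem abs_poissonQuotient_le_of_le {N c : ℝ} (hN : 0 < N) (hc : 0 < c) (hc1 : c ≤ 1)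
    (hx : Real.sin x ≠ 0) (ha : 1 / (2 * N) ≤ |a|) (hb : c / 2 ≤ |b|)
    (hab : |b * a| ≤ 2 * Real.pi / N) (u : ℝ) :
    |poissonQuotient x a b u| ≤ 8 * Real.pi / c ^ 2 * |poissonQuotient x 1 N u| := by
  have hD' := poissonQuotient_denom_pos hx one_ne_zero hN.ne' u
  unfold poissonQuotient
  set A := Real.sin ((u - x) / 2)
  set B := Real.sin ((u + x) / 2)
  have hpi := Real.pi_pos
  have h1 : (1 / (2 * N)) ^ 2 ≤ a ^ 2 := by
    rw [← sq_abs a]; exact pow_le_pow_left₀ (by positivity) ha 2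
  have h2 : (c / 2) ^ 2 ≤ b ^ 2 := by
    rw [← sq_abs b]; exact pow_le_pow_left₀ (by positivity) hb 2
  set D' := A ^ 2 * 1 ^ 2 + B ^ 2 * N ^ 2 with hD'def
  have hD : c ^ 2 / (4 * N ^ 2) * D' ≤ A ^ 2 * a ^ 2 + B ^ 2 * b ^ 2 := by
    have h3 : c ^ 2 / (4 * N ^ 2) ≤ a ^ 2 := by
      refine le_trans ?_ h1
      rw [div_pow, one_pow, mul_pow, show (2 : ℝ) ^ 2 = 4 by norm_num]
      gcongr
      exact pow_le_one₀ hc.le hc1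
    calc c ^ 2 / (4 * N ^ 2) * D' = A ^ 2 * (c ^ 2 / (4 * N ^ 2)) + B ^ 2 * (c / 2) ^ 2 := by
          rw [hD'def]; field_simp; ring
      _ ≤ _ := by gcongr
  have hpos : 0 < c ^ 2 / (4 * N ^ 2) * D' := by positivity
  rw [abs_div, abs_div, mul_assoc, abs_mul, abs_of_pos (hpos.trans_le hD), abs_of_pos hD', mul_one,
    abs_mul (Real.sin x) N, abs_of_pos hN]
  calc |Real.sin x| * |b * a| / (A ^ 2 * a ^ 2 + B ^ 2 * b ^ 2)
      ≤ |Real.sin x| * (2 * Real.pi / N) / (c ^ 2 / (4 * N ^ 2) * D') := by gcongr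
    _ = _ := by field_simp; norm_num

theorem poissonQuotient_swap (x a b u : ℝ) :
    |poissonQuotient x a b u| = |poissonQuotient (-x) b a u| := by
  unfold poissonQuotient
  rw [Real.sin_neg, sub_neg_eq_add, ← sub_eq_add_neg, neg_mul, neg_mul, neg_div, abs_neg]
  congr 1
  ring

end PoissonKernel

/-! ### Pointwise comparison of the speed with the limiting integrand -/

section PointwiseComparison

/-- The weight `1 / (1 + n |sin ((s + α) / 2) sin ((s - α) / 2)|`. -/
noncomputable def errorWeight (α : ℝ) (n : ℕ) (s : ℝ) : ℝ :=
  1 / (1 + n * |Real.sin ((s + α) / 2) * Real.sin ((s - α) / 2)|)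

/-- The majorant used to compare the normalized angular speed with its limit. -/
noncomputable def errorMajorant (α : ℝ) (n : ℕ) (s u : ℝ) : ℝ :=
  1 + |gFun α (n * α) s u| + |poissonQuotient (n * α) 1 n u| + |poissonQuotient (n * α) n 1 u|

theorem abs_sqrt_one_add_sq_sub_le (y z : ℝ) : |√(1 + y ^ 2) - √(1 + z ^ 2)| ≤ |y - z| := by
  simpa using abs_sqrt_sq_add_sq_sub_le 1 y 1 z

theorem sqrt_one_add_sq_le (y : ℝ) : √(1 + y ^ 2) ≤ 1 + |y| := by
  refine Real.sqrt_le_iff.2 ⟨by positivity, ?_⟩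
  nlinarith [abs_nonneg y, sq_abs y]

theorem abs_sin_le_add_abs_sin_half (α s : ℝ) :
    |Real.sin α| ≤ |Real.sin ((s + α) / 2)| + |Real.sin ((s - α) / 2)| := by
  have hs : Real.sin α = Real.sin ((s + α) / 2) * Real.cos ((s - α) / 2) -
      Real.cos ((s + α) / 2) * Real.sin ((s - α) / 2) := by
    rw [← Real.sin_sub]; congr 1; ring
  rw [hs]
  refine (abs_sub _ _).trans ?_
  rw [abs_mul, abs_mul]
  have h1 := Real.abs_cos_le_one ((s - α) / 2)
  have h2 := Real.abs_cos_le_one ((s + α) / 2)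
  nlinarith [abs_nonneg (Real.sin ((s + α) / 2)), abs_nonneg (Real.sin ((s - α) / 2))]

/-- Supplies the cross term of `abs_poissonQuotient_sub_le`: a shift of s by O(1/n) makes it O(|sin
α|/n). -/
theorem sin_half_cross (α s s' : ℝ) :
    Real.sin ((s' - α) / 2) * Real.sin ((s + α) / 2) -
      Real.sin ((s - α) / 2) * Real.sin ((s' + α) / 2) = Real.sin ((s' - s) / 2) * Real.sin α := by
  have h1 := Real.two_mul_sin_mul_sin ((s' - α) / 2) ((s + α) / 2)
  have h2 := Real.two_mul_sin_mul_sin ((s - α) / 2) ((s' + α) / 2)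
  have h3 := Real.two_mul_sin_mul_sin ((s' - s) / 2) α
  rw [show (s - α) / 2 - (s' + α) / 2 = -((s' - s) / 2 + α) by ring, Real.cos_neg,
    show (s - α) / 2 + (s' + α) / 2 = (s + s') / 2 by ring] at h2
  rw [show (s' - α) / 2 - (s + α) / 2 = (s' - s) / 2 - α by ring,
    show (s' - α) / 2 + (s + α) / 2 = (s + s') / 2 by ring] at h1
  linarith

variable {α : ℝ} {n : ℕ}

/-- Away from the points `±α`, the integrand of `ell` is stable under translations of size
`O(1 / n)` in the slow variable. -/
theorem abs_gFun_translate_sub_le (hx : Real.sin (n * α) ≠ 0) {s s' : ℝ} (u : ℝ) (hn : 0 < n)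
    (hss : |s' - s| ≤ 2 * Real.pi / n)
    (ha' : 2 * Real.pi / n ≤ |Real.sin ((s' + α) / 2)|)
    (hb' : 2 * Real.pi / n ≤ |Real.sin ((s' - α) / 2)|) :
    |Real.sin ((s + α) / 2)| ≤ 3 / 2 * |Real.sin ((s' + α) / 2)| ∧
    |Real.sin ((s - α) / 2)| ≤ 3 / 2 * |Real.sin ((s' - α) / 2)| ∧
    Real.pi / n ≤ |Real.sin ((s + α) / 2)| ∧ Real.pi / n ≤ |Real.sin ((s - α) / 2)| ∧
    |gFun α (n * α) s' u - gFun α (n * α) s u| ≤ |gFun α (n * α) s u| * (3 * Real.pi *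
      |Real.sin α| / (n * |Real.sin ((s + α) / 2) * Real.sin ((s - α) / 2)|)) := by
  have hn' : (0 : ℝ) < n := by exact_mod_cast hn
  have hpi := Real.pi_pos
  have hp : 0 < Real.pi / n := by positivity
  have hhalf : |(s' - s) / 2| ≤ Real.pi / n := by
    rw [abs_div, abs_two, div_le_iff₀ two_pos]
    exact hss.trans (le_of_eq (by ring))
  have hda := (Real.abs_sin_sub_sin_le ((s' + α) / 2) ((s + α) / 2)).trans
    ((congrArg abs (by ring)).trans_le hhalf)
  have hdb := (Real.abs_sin_sub_sin_le ((s' - α) / 2) ((s - α) / 2)).trans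
    ((congrArg abs (by ring)).trans_le hhalf)
  have hE := sin_half_cross α s s'
  rw [gFun_eq_poissonQuotient, gFun_eq_poissonQuotient]
  set a := Real.sin ((s + α) / 2)
  set b := Real.sin ((s - α) / 2)
  set a' := Real.sin ((s' + α) / 2)
  set b' := Real.sin ((s' - α) / 2)
  have h2p : 2 * Real.pi / n = 2 * (Real.pi / n) := by ring
  rw [h2p] at ha' hb'
  have t1 := abs_sub_abs_le_abs_sub a' a
  have t2 := abs_sub_abs_le_abs_sub b' b
  have t3 := abs_sub_abs_le_abs_sub a a'
  have t4 := abs_sub_abs_le_abs_sub b b'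
  rw [abs_sub_comm] at t3 t4
  have ha : Real.pi / n ≤ |a| := by linarith
  have hb : Real.pi / n ≤ |b| := by linarith
  have haa : |a| ≤ 3 / 2 * |a'| := by linarith
  have hbb : |b| ≤ 3 / 2 * |b'| := by linarith
  have pa : 0 < |a| := by linarith
  have pb : 0 < |b| := by linarith
  have pa' : 0 < |a'| := by linarith
  have pb' : 0 < |b'| := by linarith
  refine ⟨haa, hbb, ha, hb, ?_⟩
  refine (abs_poissonQuotient_sub_le hx (abs_pos.1 pa) (abs_pos.1 pb) (abs_pos.1 pa')
    (abs_pos.1 pb') u).trans (mul_le_mul_of_nonneg_left ?_ (abs_nonneg _))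
  have hEabs : |b' * a - b * a'| ≤ Real.pi / n * |Real.sin α| := by
    rw [hE, abs_mul]
    gcongr
    exact Real.abs_sin_le_abs.trans hhalf
  have i1 : 1 / |a' * b| ≤ 3 / 2 / |a * b| := by
    rw [abs_mul, abs_mul, div_le_div_iff₀ (by positivity) (by positivity)]
    nlinarith
  have i2 : 1 / |a * b'| ≤ 3 / 2 / |a * b| := by
    rw [abs_mul, abs_mul, div_le_div_iff₀ (by positivity) (by positivity)]
    nlinarith
  calc |b' * a - b * a'| * (1 / |a' * b| + 1 / |a * b'|)
      ≤ Real.pi / n * |Real.sin α| * (3 / 2 / |a * b| + 3 / 2 / |a * b|) := by gcongr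
    _ = _ := by
      rw [abs_mul]
      field_simp
      ring

theorem abs_normalized_angularSpeed_sub_le (hn : 0 < n) (hx : Real.sin (n * α) ≠ 0) {t : ℝ}
    (ha : Real.sin ((t + α) / 2) ≠ 0) (hb : Real.sin ((t - α) / 2) ≠ 0) :
    |2 / n * angularSpeed α n t - √(1 + gFun α (n * α) t (n * t) ^ 2)| ≤ 1 / n +
      |Real.sin α| / (2 * (n * |Real.sin ((t + α) / 2) * Real.sin ((t - α) / 2)|)) := by
  have hn' : (0 : ℝ) < n := by exact_mod_cast hn
  have h := mul_le_mul_of_nonneg_left (abs_angularSpeed_sub_le hx ha hb)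
    (show (0 : ℝ) ≤ 2 / n by positivity)
  rw [← abs_of_nonneg (show (0 : ℝ) ≤ 2 / n by positivity), ← abs_mul,
    abs_of_nonneg (show (0 : ℝ) ≤ 2 / n by positivity)] at h
  have e : 2 / (n : ℝ) * (angularSpeed α n t - n / 2 * √(1 + gFun α (n * α) t (n * t) ^ 2)) =
      2 / n * angularSpeed α n t - √(1 + gFun α (n * α) t (n * t) ^ 2) := by field_simp
  rw [e] at h
  refine h.trans (le_of_eq ?_)
  have p1 := abs_pos.2 ha
  have p2 := abs_pos.2 hb
  rw [abs_mul]
  field_simp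
  ring

theorem angularSpeed_nonneg (α : ℝ) (n : ℕ) (t : ℝ) : 0 ≤ angularSpeed α n t :=
  div_nonneg (Real.sqrt_nonneg _) (Finset.sum_nonneg fun _ _ => sq_nonneg _)

theorem normalized_angularSpeed_le {p : ℝ} (hα : Real.sin α ≠ 0) (hn : 0 < n)
    (hx : Real.sin (n * α) ≠ 0) {t : ℝ}
    (ha : 1 / (2 * n) ≤ |Real.sin ((t + α) / 2)|) (hb : 1 / (2 * n) ≤ |Real.sin ((t - α) / 2)|)
    (hab : |Real.sin α| / 2 / (2 * n) ≤ |Real.sin ((t + α) / 2) * Real.sin ((t - α) / 2)|)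
    (hp : |gFun α (n * α) t (n * t)| ≤ p) :
    2 / n * angularSpeed α n t ≤ 4 + p := by
  have hn' : (1 : ℝ) ≤ n := by exact_mod_cast hn
  have h0 : (0 : ℝ) < 1 / (2 * n) := by positivity
  have h := abs_normalized_angularSpeed_sub_le hn hx (abs_pos.1 (h0.trans_le ha))
    (abs_pos.1 (h0.trans_le hb))
  have h1 := (abs_le.1 h).2
  have h2 := sqrt_one_add_sq_le (gFun α (n * α) t (n * t))
  have h3 : 1 / (n : ℝ) ≤ 1 := by
    rw [div_le_one (by positivity)]; exact hn'
  have hs := abs_pos.2 hα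
  have h4 : |Real.sin α| / (2 * (n * |Real.sin ((t + α) / 2) * Real.sin ((t - α) / 2)|)) ≤ 2 := by
    have : |Real.sin α| / 4 ≤ n * |Real.sin ((t + α) / 2) * Real.sin ((t - α) / 2)| := by
      have := mul_le_mul_of_nonneg_left hab (show (0 : ℝ) ≤ n by positivity)
      refine le_trans (le_of_eq ?_) this
      field_simp
      norm_num
    rw [div_le_iff₀ (by linarith)]
    linarith
  linarith

theorem one_le_errorMajorant (α : ℝ) (n : ℕ) (s u : ℝ) : 1 ≤ errorMajorant α n s u := by
  rw [errorMajorant, add_assoc, add_assoc]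
  exact le_add_of_nonneg_right (by positivity)

theorem errorWeight_pos (α : ℝ) (n : ℕ) (s : ℝ) : 0 < errorWeight α n s := by
  rw [errorWeight]
  positivity

/-- Near the points `±α` the weight is bounded below. -/
theorem one_le_mul_errorWeight {s s' : ℝ} (hn : 0 < n) (hss : |s' - s| ≤ 2 * Real.pi / n)
    (hzone : |Real.sin ((s' + α) / 2)| ≤ 2 * Real.pi / n ∨
      |Real.sin ((s' - α) / 2)| ≤ 2 * Real.pi / n) : 1 ≤ 11 * errorWeight α n s := by
  have hn0 : (0 : ℝ) < n := by exact_mod_cast hn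
  have hpi := Real.pi_pos
  have hhalf : |(s' - s) / 2| ≤ Real.pi / n := by
    rw [abs_div, abs_two, div_le_iff₀ two_pos]
    exact hss.trans (le_of_eq (by ring))
  have hda := (Real.abs_sin_sub_sin_le ((s' + α) / 2) ((s + α) / 2)).trans
    ((congrArg abs (by ring)).trans_le hhalf)
  have hdb := (Real.abs_sin_sub_sin_le ((s' - α) / 2) ((s - α) / 2)).trans
    ((congrArg abs (by ring)).trans_le hhalf)
  have t1 := abs_sub_abs_le_abs_sub (Real.sin ((s + α) / 2)) (Real.sin ((s' + α) / 2))
  have t2 := abs_sub_abs_le_abs_sub (Real.sin ((s - α) / 2)) (Real.sin ((s' - α) / 2))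
  rw [abs_sub_comm] at t1 t2
  have h2p : 2 * Real.pi / n = 2 * (Real.pi / n) := by ring
  have hmin : |Real.sin ((s + α) / 2)| * |Real.sin ((s - α) / 2)| ≤ 3 * (Real.pi / n) := by
    rcases hzone with h | h
    · exact (mul_le_of_le_one_right (abs_nonneg _) (Real.abs_sin_le_one _)).trans (by linarith)
    · exact (mul_le_of_le_one_left (abs_nonneg _) (Real.abs_sin_le_one _)).trans (by linarith)
  have h3 := mul_le_mul_of_nonneg_left hmin hn0.le
  rw [show (n : ℝ) * (3 * (Real.pi / n)) = 3 * Real.pi by field_simp] at h3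
  -- The constant 11 comes from 1 + 3π < 11.
  rw [errorWeight, mul_one_div, le_div_iff₀ (by positivity), abs_mul]
  linarith [Real.pi_lt_d2]

/-- Near the points `±α`, the normalized angular speed is controlled by `errorMajorant`. -/
theorem normalized_angularSpeed_le_majorant (hα : Real.sin α ≠ 0) (hn : 0 < n)
    (hbig : 2 * Real.pi / n ≤ |Real.sin α| / 2) (hx : Real.sin (n * α) ≠ 0) (s : ℝ) {t : ℝ}
    (hzone : |Real.sin ((t + α) / 2)| ≤ 2 * Real.pi / n ∨
      |Real.sin ((t - α) / 2)| ≤ 2 * Real.pi / n) :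
    2 / n * angularSpeed α n t ≤
      8 * (1 + Real.pi / |Real.sin α| ^ 2) * errorMajorant α n s (n * t) := by
  have hn0 : (0 : ℝ) < n := by exact_mod_cast hn
  have hpi := Real.pi_pos
  have hσ : 0 < |Real.sin α| := abs_pos.2 hα
  have hσ1 := Real.abs_sin_le_one α
  have hsum := abs_sin_le_add_abs_sin_half α t
  have hTe : errorMajorant α n s (n * t) = 1 + |gFun α (n * α) s (n * t)| +
    |poissonQuotient (n * α) 1 n (n * t)| + |poissonQuotient (n * α) n 1 (n * t)| := rfl
  set T := errorMajorant α n s (n * t)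
  set σ := |Real.sin α|
  have hT1 : 1 ≤ T := one_le_errorMajorant _ _ _ _
  have hg0 := abs_nonneg (gFun α (n * α) s (n * t))
  have hp1 := abs_nonneg (poissonQuotient (n * α) 1 n (n * t))
  have hp2 := abs_nonneg (poissonQuotient (n * α) n 1 (n * t))
  have hκ0 : 0 ≤ Real.pi / σ ^ 2 := by positivity
  have hκT : 0 ≤ Real.pi / σ ^ 2 * T := mul_nonneg hκ0 (by linarith)
  -- Within 1/(2n) of a singular point the crude speed bound 4n suffices. Between 1/(2n) and 2π/n, g
  -- is dominated by the kernel with parameters (1, n) or (n, 1), which depends on t only through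
  -- the phase nt.
  by_cases hnear : |Real.sin ((t + α) / 2)| ≤ 1 / (2 * n) ∨ |Real.sin ((t - α) / 2)| ≤ 1 / (2 * n)
  · have h1 := mul_le_mul_of_nonneg_left (angularSpeed_le_of_near hnear)
      (show (0 : ℝ) ≤ 2 / n by positivity)
    rw [show 2 / (n : ℝ) * (4 * n) = 2 * 4 by field_simp] at h1
    linarith
  push Not at hnear
  obtain ⟨hna, hnb⟩ := hnear
  have hmid : ∀ p : ℝ, p ≤ T - 1 → |gFun α (n * α) t (n * t)| ≤ 8 * Real.pi / σ ^ 2 * p →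
      σ / 2 / (2 * n) ≤ |Real.sin ((t + α) / 2) * Real.sin ((t - α) / 2)| →
      2 / n * angularSpeed α n t ≤ 8 * (1 + Real.pi / σ ^ 2) * T := by
    intro p hp hgp hab
    have h1 := normalized_angularSpeed_le hα hn hx hna.le hnb.le hab hgp
    have h2 : 8 * Real.pi / σ ^ 2 * p ≤ 8 * (Real.pi / σ ^ 2 * T) := by
      rw [← mul_assoc, ← mul_div_assoc]
      gcongr
      linarith
    linarith
  have hprod : ∀ y z : ℝ, 1 / (2 * (n : ℝ)) < y → σ / 2 ≤ z → σ / 2 / (2 * n) ≤ y * z :=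
    fun y z hy hz => by
      calc σ / 2 / (2 * n) = 1 / (2 * n) * (σ / 2) := by ring
        _ ≤ _ := mul_le_mul hy.le hz (by positivity) ((by positivity : (0 : ℝ) ≤ _).trans hy.le)
  -- The two half-angle sines cannot both be small: their absolute values sum to at least σ, and
  -- `hbig` makes the small one at most σ/2.
  rcases hzone with hA | hB
  · have hB : σ / 2 ≤ |Real.sin ((t - α) / 2)| := by linarith
    refine hmid _ ?_ (abs_poissonQuotient_le_of_le (N := n) (c := σ) hn0 hσ hσ1 hx
      hna.le hB ?_ (n * t)) ?_
    · linarith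
    · rw [abs_mul]
      exact (mul_le_of_le_one_left (abs_nonneg _) (Real.abs_sin_le_one _)).trans hA
    · rw [abs_mul]
      exact hprod _ _ hna hB
  · have hA : σ / 2 ≤ |Real.sin ((t + α) / 2)| := by linarith
    have hx' : Real.sin (-(n * α)) ≠ 0 := by rwa [Real.sin_neg, neg_ne_zero]
    refine hmid _ ?_ ((poissonQuotient_swap _ _ _ _).trans_le
      (abs_poissonQuotient_le_of_le (N := n) (c := σ) hn0 hσ hσ1 hx' hnb.le hA ?_ (n * t))) ?_
    · rw [← poissonQuotient_swap]
      linarith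
    · rw [abs_mul]
      exact (mul_le_of_le_one_left (abs_nonneg _) (Real.abs_sin_le_one _)).trans hB
    · rw [abs_mul, mul_comm |Real.sin ((t + α) / 2)|]
      exact hprod _ _ hnb hA

/-- Away from the points `±α`, the normalized angular speed at a translated point is comparable
with the integrand of `ell`. -/
theorem abs_angularSpeed_translate_sub_le_of_far (hα : Real.sin α ≠ 0) (hn : 0 < n)
    (hx : Real.sin (n * α) ≠ 0) {s t : ℝ}
    (hss : |t - s| ≤ 2 * Real.pi / n)
    (hA : 2 * Real.pi / n < |Real.sin ((t + α) / 2)|)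
    (hB : 2 * Real.pi / n < |Real.sin ((t - α) / 2)|) :
    |2 / n * angularSpeed α n t - √(1 + gFun α (n * α) s (n * t) ^ 2)| ≤
      88 * (errorMajorant α n s (n * t) * errorWeight α n s) := by
  have hn' : (1 : ℝ) ≤ n := by exact_mod_cast hn
  have hn0 : (0 : ℝ) < n := by linarith
  have hpi := Real.pi_pos
  have hσ : 0 < |Real.sin α| := abs_pos.2 hα
  have hσ1 := Real.abs_sin_le_one α
  have hsum := abs_sin_le_add_abs_sin_half α s
  obtain ⟨haa, hbb, hpa, hpb, hgg⟩ := abs_gFun_translate_sub_le hx (n * t) hn hss hA.le hB.le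
  have hp0 : 0 < 2 * Real.pi / n := by positivity
  have hp0' : 0 < Real.pi / n := by positivity
  have pa' := hp0.trans hA
  have pb' := hp0.trans hB
  have pa := hp0'.trans_le hpa
  have pb := hp0'.trans_le hpb
  have hsp := abs_normalized_angularSpeed_sub_le hn hx (abs_pos.1 pa') (abs_pos.1 pb')
  have hpoint : |2 / n * angularSpeed α n t - √(1 + gFun α (n * α) s (n * t) ^ 2)| ≤
      |2 / n * angularSpeed α n t - √(1 + gFun α (n * α) t (n * t) ^ 2)| +
      |gFun α (n * α) t (n * t) - gFun α (n * α) s (n * t)| :=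
    (abs_sub_le _ _ _).trans (add_le_add le_rfl (abs_sqrt_one_add_sq_sub_le _ _))
  have hT1 := one_le_errorMajorant α n s (n * t)
  have hgT : |gFun α (n * α) s (n * t)| ≤ errorMajorant α n s (n * t) := by
    have h1 := abs_nonneg (poissonQuotient (n * α) 1 n (n * t))
    have h2 := abs_nonneg (poissonQuotient (n * α) n 1 (n * t))
    rw [errorMajorant]
    linarith
  have hw0 := (errorWeight_pos α n s).le
  have hm : errorWeight α n s =
    1 / (1 + n * |Real.sin ((s + α) / 2) * Real.sin ((s - α) / 2)|) := rfl
  set T := errorMajorant α n s (n * t)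
  set m := errorWeight α n s
  set σ := |Real.sin α|
  set y := (n : ℝ) * |Real.sin ((s + α) / 2) * Real.sin ((s - α) / 2)| with hy
  -- The smaller of the two sines is at least π/n and the larger at least σ/2. Hence y is bounded
  -- below, and σ/y is at most twice the weight.
  have hyσ : σ ≤ y := by
    have h1 : Real.pi / n * (σ / 2) ≤ |Real.sin ((s + α) / 2)| * |Real.sin ((s - α) / 2)| := by
      rcases le_total |Real.sin ((s + α) / 2)| |Real.sin ((s - α) / 2)| with h | h
      · exact mul_le_mul hpa (by linarith) (by positivity) pa.le
      · rw [mul_comm |Real.sin ((s + α) / 2)|]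
        exact mul_le_mul hpb (by linarith) (by positivity) pb.le
    rw [hy, abs_mul]
    have h2 := mul_le_mul_of_nonneg_left h1 hn0.le
    rw [show (n : ℝ) * (Real.pi / n * (σ / 2)) = Real.pi * (σ / 2) by field_simp] at h2
    refine le_trans ?_ h2
    have := mul_le_mul_of_nonneg_right (show (2 : ℝ) ≤ Real.pi by linarith [Real.pi_gt_three])
      (show 0 ≤ σ / 2 by positivity)
    linarith
  have hy0 : 0 < y := hσ.trans_le hyσ
  have hyn : y ≤ n := by
    rw [hy, abs_mul]
    exact mul_le_of_le_one_right hn0.le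
      (mul_le_one₀ (Real.abs_sin_le_one _) (abs_nonneg _) (Real.abs_sin_le_one _))
  have hσy : σ / y ≤ 2 * m := by
    rw [hm, mul_one_div, div_le_div_iff₀ hy0 (by positivity)]
    have := mul_le_of_le_one_left hy0.le hσ1
    linarith
  have h1n : 1 / (n : ℝ) ≤ 2 * m := by
    rw [hm, mul_one_div, div_le_div_iff₀ hn0 (by positivity)]
    linarith
  have hterm : σ / (2 * (n * |Real.sin ((t + α) / 2) * Real.sin ((t - α) / 2)|)) ≤
      9 / 8 * (σ / y) := by
    have hprod : |Real.sin ((s + α) / 2)| * |Real.sin ((s - α) / 2)| ≤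
        3 / 2 * |Real.sin ((t + α) / 2)| * (3 / 2 * |Real.sin ((t - α) / 2)|) :=
      mul_le_mul haa hbb pb.le (by positivity)
    have h5 : y ≤ 9 / 4 * (n * |Real.sin ((t + α) / 2) * Real.sin ((t - α) / 2)|) := by
      rw [hy, abs_mul, abs_mul]
      have := mul_le_mul_of_nonneg_left hprod hn0.le
      linarith
    rw [← mul_div_assoc, div_le_div_iff₀ (by rw [abs_mul]; positivity) hy0]
    have := mul_le_mul_of_nonneg_left h5 hσ.le
    linarith
  have hgg' : |gFun α (n * α) t (n * t) - gFun α (n * α) s (n * t)| ≤ T * (20 * m) := by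
    refine hgg.trans (mul_le_mul hgT ?_ (by positivity) (by linarith))
    rw [mul_div_assoc]
    calc 3 * Real.pi * (σ / y) ≤ 10 * (2 * m) :=
          mul_le_mul (by linarith [Real.pi_lt_d2]) hσy (by positivity) (by norm_num)
      _ = _ := by ring
  have hTm := le_mul_of_one_le_left hw0 hT1
  linarith

/-- The normalized angular speed at a translated point is comparable with the integrand of
`ell`, with an error controlled by `errorWeight`. -/
theorem abs_angularSpeed_translate_sub_le (hα : Real.sin α ≠ 0) (hn : 0 < n)
    (hbig : 4 * Real.pi / |Real.sin α| ≤ n) (hx : Real.sin (n * α) ≠ 0) {s r : ℝ} (hr0 : 0 ≤ r)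
    (hr : r ≤ 2 * Real.pi) :
    |2 / n * angularSpeed α n (s + r / n) - √(1 + gFun α (n * α) s (n * s + r) ^ 2)| ≤
      88 * (1 + Real.pi / |Real.sin α| ^ 2) *
        (errorMajorant α n s (n * s + r) * errorWeight α n s) := by
  have hn0 : (0 : ℝ) < n := by exact_mod_cast hn
  have hpi := Real.pi_pos
  have hσ : 0 < |Real.sin α| := abs_pos.2 hα
  have hus : (n : ℝ) * s + r = n * (s + r / n) := by field_simp
  have hss : |s + r / n - s| ≤ 2 * Real.pi / n := by
    rw [add_sub_cancel_left, abs_of_nonneg (by positivity)]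
    gcongr
  rw [hus]
  set t := s + r / n
  set T := errorMajorant α n s (n * t) with hT
  set m := errorWeight α n s
  set κ := Real.pi / |Real.sin α| ^ 2
  have hκ : 0 ≤ κ := by positivity
  have hT1 : 1 ≤ T := one_le_errorMajorant _ _ _ _
  have hm0 : 0 ≤ m := (errorWeight_pos α n s).le
  -- Near ±α no cancellation is used: both terms are bounded by the majorant and the weight is at
  -- least 1/11, whence 88 = 8 · 11. The far zone needs a smaller constant.
  by_cases hzone : |Real.sin ((t + α) / 2)| ≤ 2 * Real.pi / n ∨
      |Real.sin ((t - α) / 2)| ≤ 2 * Real.pi / n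
  · have hm := one_le_mul_errorWeight hn hss hzone
    have hbig' : 2 * Real.pi / n ≤ |Real.sin α| / 2 := by
      rw [div_le_iff₀ hσ] at hbig
      rw [div_le_div_iff₀ hn0 two_pos]
      linarith
    have hq := normalized_angularSpeed_le_majorant hα hn hbig' hx s hzone
    have hq0 : 0 ≤ 2 / n * angularSpeed α n t := mul_nonneg (by positivity)
      (angularSpeed_nonneg _ _ _)
    have hh0 : 0 ≤ √(1 + gFun α (n * α) s (n * t) ^ 2) := Real.sqrt_nonneg _
    have hh := sqrt_one_add_sq_le (gFun α (n * α) s (n * t))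
    have hgT : 1 + |gFun α (n * α) s (n * t)| ≤ T := by
      have h1 := abs_nonneg (poissonQuotient (n * α) 1 n (n * t))
      have h2 := abs_nonneg (poissonQuotient (n * α) n 1 (n * t))
      rw [hT, errorMajorant]
      linarith
    have hpos : 0 ≤ κ * T := mul_nonneg hκ (by linarith)
    have hle : |2 / n * angularSpeed α n t - √(1 + gFun α (n * α) s (n * t) ^ 2)| ≤
        8 * (1 + κ) * T := by
      rw [abs_le]
      constructor <;> linarith
    refine hle.trans ?_
    calc 8 * (1 + κ) * T ≤ 8 * (1 + κ) * T * (11 * m) :=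
          le_mul_of_one_le_right (by positivity) hm
      _ = _ := by ring
  · push Not at hzone
    refine (abs_angularSpeed_translate_sub_le_of_far hα hn hx hss hzone.1 hzone.2).trans ?_
    gcongr
    linarith

end PointwiseComparison

/-! ### Averaging over the fast variable -/

section Averaging

theorem integral_Icc_two_pi (f : ℝ → ℝ) :
    ∫ y in Set.Icc 0 (2 * Real.pi), f y = ∫ y in (0 : ℝ)..2 * Real.pi, f y := by
  rw [intervalIntegral.integral_of_le (by positivity), integral_Icc_eq_integral_Ioc]

theorem integral_comp_add_left_of_periodic {f : ℝ → ℝ} (hf : Function.Periodic f (2 * Real.pi))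
    (c : ℝ) : ∫ r in (0 : ℝ)..2 * Real.pi, f (c + r) = ∫ u in (0 : ℝ)..2 * Real.pi, f u := by
  rw [intervalIntegral.integral_comp_add_left, add_zero, hf.intervalIntegral_add_eq c 0, zero_add]

theorem ae_sin_half_ne_zero (c : ℝ) : ∀ᵐ s : ℝ, Real.sin ((s + c) / 2) ≠ 0 := by
  have hc : (Set.range fun k : ℤ => 2 * (k * Real.pi) - c).Countable := Set.countable_range _
  filter_upwards [hc.ae_notMem volume] with s hs h
  obtain ⟨k, hk⟩ := Real.sin_eq_zero_iff.1 h
  exact hs ⟨k, by simp only; linarith⟩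

theorem ae_sin_half_ne_zero_and (α : ℝ) :
    ∀ᵐ s : ℝ, Real.sin ((s + α) / 2) ≠ 0 ∧ Real.sin ((s - α) / 2) ≠ 0 :=
  (ae_sin_half_ne_zero α).and (by simpa [sub_eq_add_neg] using ae_sin_half_ne_zero (-α))

/-- Dominated convergence: the weight is at most 1 and tends to 0 wherever neither half-angle sine
vanishes, hence almost everywhere. No rate is needed. -/
theorem tendsto_integral_errorWeight (α : ℝ) :
    Tendsto (fun n : ℕ => ∫ s in Set.Icc 0 (2 * Real.pi), errorWeight α n s) atTop (𝓝 0) := by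
  suffices h : Tendsto (fun n : ℕ => ∫ s in Set.Icc 0 (2 * Real.pi), errorWeight α n s) atTop
      (𝓝 (∫ s in Set.Icc 0 (2 * Real.pi), (0 : ℝ))) by simpa using h
  refine tendsto_integral_of_dominated_convergence (fun _ => 1) (fun n => ?_)
    continuous_const.integrableOn_Icc (fun n => ae_of_all _ fun s => ?_) ?_
  · refine Continuous.aestronglyMeasurable ?_
    unfold errorWeight
    exact Continuous.div (by fun_prop) (by fun_prop) fun s => by positivity
  · rw [Real.norm_of_nonneg (errorWeight_pos α n s).le, errorWeight]
    exact div_le_one_of_le₀ (le_add_of_nonneg_right (by positivity)) (by positivity)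
  · filter_upwards [ae_restrict_of_ae (ae_sin_half_ne_zero_and α)] with s hs
    have hp : 0 < |Real.sin ((s + α) / 2) * Real.sin ((s - α) / 2)| :=
      abs_pos.2 (mul_ne_zero hs.1 hs.2)
    exact tendsto_const_nhds.div_atTop
      (tendsto_atTop_add_const_left _ _ (tendsto_natCast_atTop_atTop.atTop_mul_const hp))

variable {α x : ℝ}

theorem measurable_gFun (α x : ℝ) : Measurable fun p : ℝ × ℝ => gFun α x p.1 p.2 := by
  unfold gFun
  fun_prop

theorem integral_abs_gFun_le (hx : Real.sin x ≠ 0) {s : ℝ}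
    (hs : Real.sin ((s + α) / 2) ≠ 0 ∧ Real.sin ((s - α) / 2) ≠ 0) :
    Continuous (gFun α x s) ∧ ∫ u in (0 : ℝ)..2 * Real.pi, |gFun α x s u| ≤ 2 * Real.pi :=
  ⟨continuous_poissonQuotient hx hs.1 hs.2, integral_abs_poissonQuotient_le hx hs.1 hs.2⟩

theorem volume_restrict_torusSquare :
    (volume : Measure (ℝ × ℝ)).restrict torusSquare =
      (volume.restrict (Set.Icc 0 (2 * Real.pi))).prod
        (volume.restrict (Set.Icc 0 (2 * Real.pi))) := by
  rw [torusSquare, Measure.volume_eq_prod, Measure.prod_restrict]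

/-- Although g blows up at points of the square, for almost every s its integral over u is at most
2π, so Tonelli applies. -/
theorem integrableOn_ellIntegrand (α : ℝ) (hx : Real.sin x ≠ 0) :
    IntegrableOn (ellIntegrand α x) torusSquare := by
  rw [IntegrableOn, volume_restrict_torusSquare]
  have hm := measurable_gFun α x
  have hg : Integrable (fun p : ℝ × ℝ => |gFun α x p.1 p.2|)
      ((volume.restrict (Set.Icc 0 (2 * Real.pi))).prod
        (volume.restrict (Set.Icc 0 (2 * Real.pi)))) := by
    have hsm : AEStronglyMeasurable (fun p : ℝ × ℝ => |gFun α x p.1 p.2|)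
      ((volume.restrict (Set.Icc 0 (2 * Real.pi))).prod
        (volume.restrict (Set.Icc 0 (2 * Real.pi)))) :=
      (continuous_abs.measurable.comp hm).aestronglyMeasurable
    rw [integrable_prod_iff hsm]
    refine ⟨?_, ?_⟩
    · filter_upwards [ae_restrict_of_ae (ae_sin_half_ne_zero_and α)] with s hs
      exact (integral_abs_gFun_le hx hs).1.abs.continuousOn.integrableOn_Icc
    · refine Integrable.mono' (g := fun _ => 2 * Real.pi) (integrable_const _)
        hsm.norm.integral_prod_right' ?_
      filter_upwards [ae_restrict_of_ae (ae_sin_half_ne_zero_and α)] with s hs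
      rw [Real.norm_of_nonneg (integral_nonneg fun u => norm_nonneg _)]
      simp only [Real.norm_eq_abs, abs_abs]
      rw [integral_Icc_two_pi]
      exact (integral_abs_gFun_le hx hs).2
  refine ((integrable_const (1 : ℝ)).add hg).mono' ?_ (ae_of_all _ fun p => ?_)
  · unfold ellIntegrand
    exact (Real.continuous_sqrt.measurable.comp
      (((continuous_abs.measurable.comp hm).pow_const 2).const_add 1)).aestronglyMeasurable
  · rw [ellIntegrand, Real.norm_of_nonneg (Real.sqrt_nonneg _), sq_abs]
    exact sqrt_one_add_sq_le _

theorem gFun_periodic (α x s : ℝ) : Function.Periodic (gFun α x s) (2 * Real.pi) :=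
  poissonQuotient_periodic x _ _

/-- Shifting x by mπ amounts, up to sign, to translating u by mπ. The integral over a period of u
thus sees only nα modulo π. -/
theorem gFun_add_int_mul_pi_sq (α x s u : ℝ) (m : ℤ) :
    gFun α (x + m * Real.pi) s u ^ 2 = gFun α x s (u - m * Real.pi) ^ 2 := by
  have hs : ∀ y : ℝ, Real.sin (y + m * Real.pi) ^ 2 = Real.sin y ^ 2 := fun y => by
    rw [Real.sin_add_int_mul_pi, mul_pow]
    have : ((-1 : ℝ) ^ m) ^ 2 = 1 := by
      rcases Int.even_or_odd m with h | h
      · simp [h.neg_one_zpow]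
      · simp [h.neg_one_zpow]
    rw [this, one_mul]
  have e1 : Real.sin ((u - (x + m * Real.pi)) / 2) ^ 2 =
      Real.sin ((u - m * Real.pi - x) / 2) ^ 2 := by congr 3; ring
  have e2 : Real.sin ((u + (x + m * Real.pi)) / 2) ^ 2 =
      Real.sin ((u - m * Real.pi + x) / 2) ^ 2 := by
    rw [← hs ((u - m * Real.pi + x) / 2)]; congr 2; ring
  rw [gFun, gFun, e1, e2, div_pow, div_pow, mul_pow, mul_pow, mul_pow, mul_pow, hs]

theorem angularSpeed_periodic (α : ℝ) (n : ℕ) :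
    Function.Periodic (angularSpeed α n) (2 * Real.pi) := fun t => by
  have hc : ∀ k : ℕ, Real.cos (k * (t + 2 * Real.pi)) = Real.cos (k * t) := fun k => by
    rw [mul_add, Real.cos_add_nat_mul_two_pi]
  have hs : ∀ k : ℕ, Real.sin (k * (t + 2 * Real.pi)) = Real.sin (k * t) := fun k => by
    rw [mul_add, Real.sin_add_nat_mul_two_pi]
  have h1 : cosineCurve α n (t + 2 * Real.pi) = cosineCurve α n t := by
    simp only [cosineCurve, hc, hs]
  have h2 : cosineCurveDeriv α n (t + 2 * Real.pi) = cosineCurveDeriv α n t := by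
    simp only [cosineCurveDeriv, hc, hs]
  rw [angularSpeed, h1, h2, angularSpeed]

theorem integral_ellIntegrand (hx : Real.sin x ≠ 0) (m : ℤ) :
    Integrable (fun s => ∫ u in (0 : ℝ)..2 * Real.pi, √(1 + gFun α (x + m * Real.pi) s u ^ 2))
      (volume.restrict (Set.Icc 0 (2 * Real.pi))) ∧
    ∫ p in torusSquare, ellIntegrand α x p = ∫ s in Set.Icc 0 (2 * Real.pi),
      ∫ u in (0 : ℝ)..2 * Real.pi, √(1 + gFun α (x + m * Real.pi) s u ^ 2) := by
  have h1 : ∀ s, ∫ u in (0 : ℝ)..2 * Real.pi, √(1 + gFun α (x + m * Real.pi) s u ^ 2) =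
      ∫ u in Set.Icc 0 (2 * Real.pi), ellIntegrand α x (s, u) := fun s => by
    rw [integral_Icc_two_pi]
    have hper : Function.Periodic (fun u => √(1 + gFun α x s u ^ 2)) (2 * Real.pi) := fun u => by
      simp only [gFun_periodic α x s u]
    have := integral_comp_add_left_of_periodic hper (-(m * Real.pi))
    simp only [ellIntegrand, sq_abs]
    rw [← this]
    refine intervalIntegral.integral_congr fun u _ => ?_
    rw [gFun_add_int_mul_pi_sq, neg_add_eq_sub]
  have hint := integrableOn_ellIntegrand α hx
  rw [IntegrableOn, volume_restrict_torusSquare] at hint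
  simp_rw [h1]
  refine ⟨hint.integral_prod_left, ?_⟩
  rw [volume_restrict_torusSquare, integral_prod _ hint]

/-- Averaging the normalized angular speed over one period of the fast variable. -/
theorem integral_integral_translate {f : ℝ → ℝ} (hf : Continuous f)
    (hper : Function.Periodic f (2 * Real.pi)) (c : ℝ) :
    Integrable (fun s => ∫ r in (0 : ℝ)..2 * Real.pi, f (s + r / c))
      (volume.restrict (Set.Icc 0 (2 * Real.pi))) ∧
    ∫ s in Set.Icc 0 (2 * Real.pi), ∫ r in (0 : ℝ)..2 * Real.pi, f (s + r / c) =
      2 * Real.pi * ∫ t in (0 : ℝ)..2 * Real.pi, f t := by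
  have hint : Integrable (Function.uncurry fun s r : ℝ => f (s + r / c))
      ((volume.restrict (Set.Icc 0 (2 * Real.pi))).prod
        (volume.restrict (Set.Icc 0 (2 * Real.pi)))) := by
    rw [← volume_restrict_torusSquare]
    refine ContinuousOn.integrableOn_compact (isCompact_Icc.prod isCompact_Icc) ?_
    exact Continuous.continuousOn (by unfold Function.uncurry; fun_prop)
  simp_rw [← integral_Icc_two_pi (fun r => f (_ + r / c))]
  refine ⟨hint.integral_prod_left, ?_⟩
  rw [integral_integral_swap hint]
  have h : ∀ r : ℝ, ∫ s in Set.Icc 0 (2 * Real.pi), f (s + r / c) =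
      ∫ t in (0 : ℝ)..2 * Real.pi, f t := fun r => by
    rw [integral_Icc_two_pi, ← integral_comp_add_left_of_periodic hper (r / c)]
    simp_rw [add_comm]
  simp_rw [h]
  rw [integral_const]
  simp [Real.pi_pos.le]

/-- Each of the four summands (the constant and three kernels) contributes at most 2π. -/
theorem integral_errorMajorant_le {n : ℕ} (hn : n ≠ 0) (hx : Real.sin (n * α) ≠ 0) {s : ℝ}
    (hs : Real.sin ((s + α) / 2) ≠ 0 ∧ Real.sin ((s - α) / 2) ≠ 0) (c : ℝ) :
    Continuous (errorMajorant α n s) ∧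
      ∫ r in (0 : ℝ)..2 * Real.pi, errorMajorant α n s (c + r) ≤ 8 * Real.pi := by
  have hn' : (n : ℝ) ≠ 0 := by exact_mod_cast hn
  obtain ⟨hc0, h0⟩ := integral_abs_gFun_le hx hs
  have hc1 := continuous_poissonQuotient hx one_ne_zero hn'
  have hc2 := continuous_poissonQuotient hx hn' one_ne_zero
  have h1 := integral_abs_poissonQuotient_le hx one_ne_zero hn'
  have h2 := integral_abs_poissonQuotient_le hx hn' one_ne_zero
  have hc : Continuous (errorMajorant α n s) := by unfold errorMajorant; fun_prop
  refine ⟨hc, ?_⟩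
  have hper : Function.Periodic (errorMajorant α n s) (2 * Real.pi) := fun u => by
    rw [errorMajorant, gFun_periodic, poissonQuotient_periodic, poissonQuotient_periodic,
      errorMajorant]
  rw [integral_comp_add_left_of_periodic hper]
  unfold errorMajorant
  have i0 := hc0.abs.intervalIntegrable (μ := volume) 0 (2 * Real.pi)
  have i1 := hc1.abs.intervalIntegrable (μ := volume) 0 (2 * Real.pi)
  have i2 := hc2.abs.intervalIntegrable (μ := volume) 0 (2 * Real.pi)
  have i3 : IntervalIntegrable (fun _ : ℝ => (1 : ℝ)) volume 0 (2 * Real.pi) :=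
    intervalIntegrable_const
  rw [intervalIntegral.integral_add ((i3.add i0).add i1) i2,
    intervalIntegral.integral_add (i3.add i0) i1, intervalIntegral.integral_add i3 i0]
  simp only [intervalIntegral.integral_const, smul_eq_mul, mul_one, sub_zero]
  linarith

/-- The mean normalized angular speed is close to `ell`. -/
theorem abs_integral_angularSpeed_sub_ell_le {n : ℕ} (hα : Real.sin α ≠ 0) (hn : 0 < n)
    (hbig : 4 * Real.pi / |Real.sin α| ≤ n) (hx : Real.sin x ≠ 0) (m : ℤ)
    (hm : n * α = x + m * Real.pi) :
    |(∫ t in (0 : ℝ)..2 * Real.pi, angularSpeed α n t / Real.pi) / n - ell α x| ≤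
      176 * (1 + Real.pi / |Real.sin α| ^ 2) / Real.pi *
        ∫ s in Set.Icc 0 (2 * Real.pi), errorWeight α n s := by
  have hpi := Real.pi_pos
  have hn0 : (0 : ℝ) < n := by exact_mod_cast hn
  have hxn : Real.sin (n * α) ≠ 0 := by
    rw [hm, Real.sin_add_int_mul_pi]
    exact mul_ne_zero (zpow_ne_zero _ (by norm_num)) hx
  have hcs := continuous_angularSpeed (sum_cosineCurve_sq_pos hxn)
  have hq : Continuous fun t => 2 / n * angularSpeed α n t := continuous_const.mul hcs
  have hqper : Function.Periodic (fun t => 2 / n * angularSpeed α n t) (2 * Real.pi) := fun t => by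
    simp only [angularSpeed_periodic α n t]
  -- The speed is periodic, so averaging it over all translates s + r/n only multiplies its integral
  -- by 2π.
  obtain ⟨hi1, he1⟩ := integral_integral_translate hq hqper n
  obtain ⟨hi2, he2⟩ := integral_ellIntegrand (α := α) hx m
  rw [← hm] at hi2 he2
  set K := 88 * (1 + Real.pi / |Real.sin α| ^ 2) with hK
  have hK0 : 0 ≤ K := by positivity
  have hwi : Integrable (errorWeight α n) (volume.restrict (Set.Icc 0 (2 * Real.pi))) := by
    refine Continuous.integrableOn_Icc ?_
    unfold errorWeight
    exact Continuous.div (by fun_prop) (by fun_prop) fun s => by positivity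
  have hbound : ∀ᵐ s ∂(volume.restrict (Set.Icc 0 (2 * Real.pi))),
      ‖(∫ r in (0 : ℝ)..2 * Real.pi, 2 / n * angularSpeed α n (s + r / n)) -
        ∫ u in (0 : ℝ)..2 * Real.pi, √(1 + gFun α (n * α) s u ^ 2)‖ ≤
      8 * Real.pi * K * errorWeight α n s := by
    filter_upwards [ae_restrict_of_ae (ae_sin_half_ne_zero_and α)] with s hs
    have hg := (integral_abs_gFun_le (α := α) hxn hs).1
    have hh : Continuous fun u => √(1 + gFun α (n * α) s u ^ 2) := by fun_prop
    have hper : Function.Periodic (fun u => √(1 + gFun α (n * α) s u ^ 2)) (2 * Real.pi) :=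
      fun u => by simp only [gFun_periodic α (n * α) s u]
    obtain ⟨hTc, hT⟩ := integral_errorMajorant_le (α := α) hn.ne' hxn hs (n * s)
    have hw := (errorWeight_pos α n s).le
    have hi3 : IntervalIntegrable (fun r => 2 / n * angularSpeed α n (s + r / n)) volume 0
        (2 * Real.pi) := Continuous.intervalIntegrable (hq.comp (by fun_prop)) _ _
    have hi4 : IntervalIntegrable (fun r => √(1 + gFun α (n * α) s (n * s + r) ^ 2)) volume 0
        (2 * Real.pi) :=
      Continuous.intervalIntegrable (hh.comp (continuous_const.add continuous_id)) _ _
    -- For fixed s the phase ns + r runs through one full period, so the limiting integrand may be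
    -- written in the variable r and compared pointwise.
    rw [← integral_comp_add_left_of_periodic hper (n * s), ← intervalIntegral.integral_sub hi3 hi4]
    refine (intervalIntegral.norm_integral_le_of_norm_le (g := fun r =>
      K * (errorMajorant α n s (n * s + r) * errorWeight α n s)) (by positivity)
      (ae_of_all _ fun r hr => abs_angularSpeed_translate_sub_le hα hn hbig hxn hr.1.le hr.2)
      (Continuous.intervalIntegrable (by fun_prop) _ _)).trans ?_
    rw [intervalIntegral.integral_const_mul, intervalIntegral.integral_mul_const]
    calc K * ((∫ r in (0 : ℝ)..2 * Real.pi, errorMajorant α n s (n * s + r)) * errorWeight α n s)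
        ≤ K * (8 * Real.pi * errorWeight α n s) := by gcongr
      _ = _ := by ring
  have hmain := norm_integral_le_of_norm_le (hwi.const_mul (8 * Real.pi * K)) hbound
  rw [integral_sub hi1 hi2, he1, ← he2, integral_const_mul, Real.norm_eq_abs,
    intervalIntegral.integral_const_mul] at hmain
  rw [intervalIntegral.integral_div, ell]
  have e : (∫ t in (0 : ℝ)..2 * Real.pi, angularSpeed α n t) / Real.pi / n -
      1 / (4 * Real.pi ^ 2) * ∫ p in torusSquare, ellIntegrand α x p =
      1 / (4 * Real.pi ^ 2) * (2 * Real.pi * (2 / n *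
        ∫ t in (0 : ℝ)..2 * Real.pi, angularSpeed α n t) -
        ∫ p in torusSquare, ellIntegrand α x p) := by
    field_simp
    ring
  rw [e, abs_mul, abs_of_pos (by positivity)]
  refine (mul_le_mul_of_nonneg_left hmain (by positivity)).trans (le_of_eq ?_)
  rw [hK]
  field_simp
  ring

end Averaging

/-! ### Conclusion -/

theorem theorem1 (α : ℝ) (hα : 0 ≤ α) (β : ℝ) (hβ0 : 0 < β) (hβ1 : β < 1) :
    ∃ (C : ℝ) (η : ℕ → ℝ), Tendsto η atTop (𝓝 0) ∧
      ∀ᶠ n : ℕ in atTop, (∀ m : ℤ, (n : ℝ) * α ≠ (m : ℝ) * Real.pi) →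
        IntegrableOn (ellIntegrand α (toIcoMod Real.pi_pos 0 ((n : ℝ) * α))) torusSquare ∧
        ∀ (Ω : Type*) [MeasurableSpace Ω] (P : Measure Ω) (a b : ℕ → Ω → ℝ),
          IsCosineCoefficients P α a b →
            AEMeasurable (numZeros a b n) P ∧
            ∫⁻ ω, numZeros a b n ω ∂P < ∞ ∧
            |(∫⁻ ω, numZeros a b n ω ∂P).toReal / (n : ℝ)
                - ell α (toIcoMod Real.pi_pos 0 ((n : ℝ) * α))|
              ≤ C * (1 / ((n : ℝ) ^ β * (1 - |Real.cos ((n : ℝ) * α)|) ^ 2)) + η n := by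
  -- The comparison is uniform in nα modulo π, so the singular term is not needed and C = 0.
  refine ⟨0, fun n => 176 * (1 + Real.pi / |Real.sin α| ^ 2) / Real.pi *
    ∫ s in Set.Icc 0 (2 * Real.pi), errorWeight α n s, ?_, ?_⟩
  · simpa using (tendsto_integral_errorWeight α).const_mul _
  filter_upwards [eventually_gt_atTop 0,
    tendsto_natCast_atTop_atTop.eventually_ge_atTop (4 * Real.pi / |Real.sin α|)]
    with n hn hbig hnα
  -- If α were in πℤ then nα would be too; the excluded case thus covers all degenerate α.
  have hsin : Real.sin α ≠ 0 := fun h => by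
    obtain ⟨k, hk⟩ := Real.sin_eq_zero_iff.1 h
    exact hnα (n * k) (by rw [← hk]; push_cast; ring)
  set x := toIcoMod Real.pi_pos 0 ((n : ℝ) * α) with hx
  set m := toIcoDiv Real.pi_pos 0 ((n : ℝ) * α)
  have hm : n * α = x + m * Real.pi := by
    have := toIcoMod_add_toIcoDiv_zsmul Real.pi_pos 0 ((n : ℝ) * α)
    rw [zsmul_eq_mul] at this
    exact this.symm
  have hxs : Real.sin x ≠ 0 := fun h => by
    obtain ⟨k, hk⟩ := Real.sin_eq_zero_iff.1 h
    exact hnα (k + m) (by rw [hm, ← hk]; push_cast; ring)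
  have hxn : Real.sin (n * α) ≠ 0 := fun h => by
    obtain ⟨k, hk⟩ := Real.sin_eq_zero_iff.1 h
    exact hnα k hk.symm
  refine ⟨integrableOn_ellIntegrand α hxs, fun Ω _ P a b h => ?_⟩
  obtain ⟨h1, h2⟩ := lintegral_numZeros hsin hn.ne' (sum_cosineCurve_sq_pos hxn) h
  refine ⟨h1, h2 ▸ ENNReal.ofReal_lt_top, ?_⟩
  rw [h2, ENNReal.toReal_ofReal, zero_mul, zero_add]
  · exact abs_integral_angularSpeed_sub_ell_le hsin hn hbig hxs m hm
  · exact intervalIntegral.integral_nonneg (by positivity) fun t _ =>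
      div_nonneg (angularSpeed_nonneg α n t) Real.pi_pos.le
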